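/- Let $d\ge 1$ be an integer and $q\ge 1$ a real number. Consider the lattice $\mathbb{Z}^d$ with edge set $\mathbb{E}$ consisting of the pairs $xy$ with $\|x-y\|=1$. For $n\ge 0$ let $\Lambda_n=[-n,n]^d\cap\mathbb{Z}^d$, let $E_n$ be the set of edges between two vertices of $\Lambda_n$, and let $\partial\Lambda_n$ be the set of $x\in\Lambda_n$ that are an endpoint of an edge in $\mathbb{E}\setminus E_n$. For $p\in[0,1]$, let $\phi^1_{\Lambda_n,p,q}$ be the random-cluster measure on $\Lambda_n$ with wired boundary conditions, i.e. the probability measure on $\{0,1\}^{E_n}$ given by $$\phi^1_{\Lambda_n,p,q}[\omega]=\frac{p^{o(\omega)}(1-p)^{c(\omega)}q^{k(\omega^1)}}{Z^1_{\Lambda_n,p,q}},$$ where $o(\omega)$ and $c(\omega)$ are the numbers of open ($\omega_e=1$) and closed ($\omega_e=0$) edges, $k(\omega^1)$ is the number of connected components of the graph obtained from $(\Lambda_n,\{e\in E_n:\omega_e=1\})$ by contracting all the vertices of $\partial\Lambda_n$ into one vertex, and $Z^1_{\Lambda_n,p,q}$ is the normalizing constant. Write $0\leftrightarrow\partial\Lambda_n$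 for the event that $0$ is connected to a vertex of $\partial\Lambda_n$ by open edges, and $0\leftrightarrow\infty$ for the event that the set of vertices connected to $0$ by open edges is infinite. For every $p\in[0,1]$, there is a (unique) probability measure $\phi^1_{p,q}$ on $\{0,1\}^{\mathbb{E}}$ such that $\phi^1_{p,q}[\mathcal{A}]=\lim_{n\to\infty}\phi^1_{\Lambda_n,p,q}[\mathcal{A}]$ for every event $\mathcal{A}$ depending on finitely many edges. Let $$p_c=p_c(q,d):=\inf\{p\in(0,1]:\phi^1_{p,q}[0\leftrightarrow\infty]>0\}.$$ Then the phase transition is sharp, in the following sense. 1. (Mean-field lower bound) There exists $c=c(q,d)>0$ such that for every $p\in[0,1]$ with $p>p_c$, $$\phi^1_{p,q}[0\leftrightarrow\infty]\ge c\,(p-p_c).$$ 2. (Exponential decay) For every $p\in[0,1]$ with $p<p_c$, there exists $c_p>0$ (depending on $p$, $q$, $d$) such that for all $n\ge 1$, $$\phi^1_{\Lambda_n,p,q}[0\leftrightarrow\partial\Lambda_n]\le\exp(-c_p\,n).$$ -/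

import Mathlib

open MeasureTheory Filter Topology

noncomputable section

namespace RandomCluster

/-- The lattice `ℤ^d`: vertex set `ℤ^d`, with an edge between `x` and `y` iff `‖x - y‖ = 1`.
(For integer vectors the Euclidean and the `ℓ¹` norm are equal to `1` for the same vectors.) -/
def lattice (d : ℕ) : SimpleGraph (Fin d → ℤ) where
  Adj x y := ∑ i, |x i - y i| = 1
  symm := ⟨fun x y h => by simpa only [abs_sub_comm] using h⟩
  loopless := ⟨fun x h => by simp at h⟩

/-- A percolation configuration on `G`, an element of `{0,1}^E` (`true` = open, `false` = closed),
with the product `σ`-algebra. -/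
abbrev Config {V : Type*} (G : SimpleGraph V) : Type _ := G.edgeSet → Bool

section Percolation

variable {V : Type*} {G : SimpleGraph V}

/-- The configuration `ω` seen as a graph: all the vertices of `G`, and the open edges. -/
def openGraph (ω : Config G) : SimpleGraph V :=
  SimpleGraph.fromEdgeSet {e | ∃ h : e ∈ G.edgeSet, ω ⟨e, h⟩ = true}

/-- The event `A ↔ B`: some vertex of `A` is connected to some vertex of `B`. -/
def connected (G : SimpleGraph V) (A B : Set V) : Set (Config G) :=
  {ω | ∃ x ∈ A, ∃ y ∈ B, (openGraph ω).Reachable x y}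

/-- The event `x ↔ ∞`: the cluster of `x` is infinite. -/
def connectedToInfinity (G : SimpleGraph V) (x : V) : Set (Config G) :=
  {ω | {y | (openGraph ω).Reachable x y}.Infinite}

/-- The number `o(ω)` of open edges. -/
def numOpen (ω : Config G) : ℕ := Nat.card {e : G.edgeSet // ω e = true}

/-- The number `c(ω)` of closed edges. -/
def numClosed (ω : Config G) : ℕ := Nat.card {e : G.edgeSet // ω e = false}

/-- The graph `ω^ξ`: every class of the partition `ξ` is contracted into one vertex.
A partition of the boundary is represented by the partition of the vertex set `V` that has
moreover the singletons `{x}`, for `x` not in the boundary, as classes. -/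
def contract (ω : Config G) (ξ : Setoid V) : SimpleGraph (Quotient ξ) :=
  (openGraph ω).map (Quotient.mk ξ)

/-- The number `k(ω^ξ)` of clusters of `ω^ξ`. -/
def numClusters (ω : Config G) (ξ : Setoid V) : ℕ :=
  Nat.card (contract ω ξ).ConnectedComponent

/-- Wired boundary conditions: all the vertices of the boundary `B` are in the same class. -/
def wired (B : Set V) : Setoid V where
  r x y := x = y ∨ (x ∈ B ∧ y ∈ B)
  iseqv :=
    { refl := fun _ => Or.inl rfl
      symm := by
        rintro x y (h | ⟨hx, hy⟩)
        · exact Or.inl h.symm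
        · exact Or.inr ⟨hy, hx⟩
      trans := by
        rintro x y z (rfl | ⟨hx, hy⟩) (rfl | ⟨hy', hz⟩)
        · exact Or.inl rfl
        · exact Or.inr ⟨hy', hz⟩
        · exact Or.inr ⟨hx, hy⟩
        · exact Or.inr ⟨hx, hz⟩ }

/-- The weight `p^{o(ω)} (1-p)^{c(ω)} q^{k(ω^ξ)}`. -/
def weight (ξ : Setoid V) (p q : ℝ) (ω : Config G) : ℝ :=
  p ^ numOpen ω * (1 - p) ^ numClosed ω * q ^ numClusters ω ξ

open Classical in
/-- The partition function `Z^ξ_{G,p,q}` of a finite graph. -/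
def partitionFunction [Fintype V] (G : SimpleGraph V) (ξ : Setoid V) (p q : ℝ) : ℝ :=
  ∑ ω : Config G, weight ξ p q ω

open Classical in
/-- The random-cluster measure `φ^ξ_{G,p,q}` on a finite graph: the configuration `ω` has
probability `p^{o(ω)} (1-p)^{c(ω)} q^{k(ω^ξ)} / Z^ξ_{G,p,q}`. -/
def finiteMeasure [Fintype V] (G : SimpleGraph V) (ξ : Setoid V) (p q : ℝ) :
    Measure (Config G) :=
  ∑ ω : Config G, ENNReal.ofReal (weight ξ p q ω / partitionFunction G ξ p q) • Measure.dirac ω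

end Percolation

/-- The box `Λ_n = [-n,n]^d ∩ ℤ^d`. -/
abbrev box (d n : ℕ) : Set (Fin d → ℤ) := Set.Icc (fun _ => -(n : ℤ)) (fun _ => (n : ℤ))

/-- The graph `Λ_n`, whose edge set `E_n` consists of all edges of `ℤ^d` between two vertices
of `Λ_n`. -/
abbrev boxGraph (d n : ℕ) : SimpleGraph (box d n) := (lattice d).induce (box d n)

/-- The boundary `∂Λ_n`: the vertices of `Λ_n` incident to an edge of `ℤ^d` that is not in `E_n`,
that is, to an edge whose other endpoint is outside `Λ_n`. -/
def boxBoundary (d n : ℕ) : Set (box d n) :=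
  {x | ∃ y : Fin d → ℤ, y ∉ box d n ∧ (lattice d).Adj x y}

/-- The origin, as a vertex of `Λ_n`. -/
def origin (d n : ℕ) : box d n :=
  ⟨0, ⟨fun _ => by simp, fun _ => by simp⟩⟩

/-- The measure `φ^1_{Λ_n,p,q}` on `{0,1}^{E_n}`. -/
def boxMeasure (d n : ℕ) (p q : ℝ) : Measure (Config (boxGraph d n)) :=
  finiteMeasure (boxGraph d n) (wired (boxBoundary d n)) p q

open Classical in
/-- A configuration on `Λ_n` seen as a configuration on `ℤ^d`, the edges outside `E_n` being
closed. It serves only to evaluate on `{0,1}^{E_n}` an event that depends on finitely many edges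
of `ℤ^d`; as soon as these edges are all in `E_n`, the values outside `E_n` are irrelevant. -/
def extend {d n : ℕ} (ω : Config (boxGraph d n)) : Config (lattice d) :=
  fun e => decide (∃ f : (boxGraph d n).edgeSet,
    Sym2.map Subtype.val (f : Sym2 (box d n)) = (e : Sym2 (Fin d → ℤ)) ∧ ω f = true)

/-- `φ` is the infinite-volume random-cluster measure with wired boundary conditions: a
probability measure on `{0,1}^𝔼` with `φ[A] = lim φ^1_{Λ_n,p,q}[A]` for every event `A` that
depends on finitely many edges. -/
def IsWiredLimit (d : ℕ) (p q : ℝ) (φ : Measure (Config (lattice d))) : Prop :=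
  IsProbabilityMeasure φ ∧
    ∀ A ∈ measurableCylinders (fun _ : (lattice d).edgeSet => Bool),
      Tendsto (fun n : ℕ => (boxMeasure d n p q).real {ω | extend ω ∈ A}) atTop (𝓝 (φ.real A))

open Classical in
/-- The infinite-volume measure `φ^1_{p,q}`. -/
def wiredMeasure (d : ℕ) (p q : ℝ) : Measure (Config (lattice d)) :=
  if h : ∃ φ, IsWiredLimit d p q φ then h.choose else 0

/-- The critical parameter `p_c(q,d) = inf {p > 0 : φ^1_{p,q}[0 ↔ ∞] > 0}`, where `p` ranges
over edge-weights, that is, over `[0,1]`. -/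
def criticalParameter (d : ℕ) (q : ℝ) : ℝ :=
  sInf {p : ℝ | 0 < p ∧ p ≤ 1 ∧ 0 < (wiredMeasure d p q).real (connectedToInfinity (lattice d) 0)}

end RandomCluster

end

/-! The proof combines an OSSS inequality for monotone (log-supermodular) measures with a
differential inequality for connection probabilities, following the approach of Duminil-Copin,
Raoufi and Tassion.

For `q ≥ 1` the number of clusters is supermodular in the configuration, so the weights are
log-supermodular: FKG and Holley's comparison apply, and enlarging a wired box lowers the
probability of increasing events (`boxEv_pull_le`). This gives the infinite-volume limit:
expectations of increasing local functions are monotone in the box, and compactness supplies a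
measure.

Let `θ_n(p)` be the probability of `0 ↔ ∂Λ_n` under the wired measure on `Λ_{2n}`. The OSSS
inequality (`osss`) bounds the variance of an increasing function by the sum over edges of
(revealment) × (covariance with the edge). For each `k < n`, the event can be decided by exploring
the clusters of `∂Λ_k` in `Λ_n`. An edge at `v` is revealed only if `v ↔ ∂Λ_k`, and since the box
has radius `2n`, a translated box around `v` fits inside and bounds this probability by some `θ_j`
with `j` about half the distance from `v` to `∂Λ_k`. Summing over `k` and using Russo's formula
gives `n θ_n (1 - θ_n) ≤ 8 (∑_{i<n} θ_i) θ_n'` (`hasDerivAt_theta`). Away from `p = 1` the factor `1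
- θ_n` is bounded below.

Write `S_n = ∑_{i<n} θ_i`. The inequality `c n θ_n ≤ S_n θ_n'` forces a dichotomy. If `S_n ≤
n^{1-ε}` eventually at `b`, two applications of Grönwall give first stretched-exponential and then
exponential decay below `b` (`exists_exp_decay`). If instead `log S_n` is almost `log n` infinitely
often at `a`, integrating `∑ θ_i / i` shows that the limit of `θ_n` is at least linear above `a`
(`mul_sub_le_limit`). As `θ_n` converges to the percolation probability (`tendsto_theta`), the
second alternative fails below `p_c`, and it holds above `p_c`. -/

namespace RandomCluster

/-! ### Expectations under finite weights; Holley and FKG -/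

section Expectation

variable {α : Type*} [Fintype α]

/-- The expectation of `g` under the probability measure proportional to the weight `w`. -/
noncomputable def ev (w g : α → ℝ) : ℝ := (∑ ω, w ω * g ω) / ∑ ω, w ω

theorem ev_add (w f g : α → ℝ) : ev w (fun ω => f ω + g ω) = ev w f + ev w g := by
  simp only [ev, mul_add, Finset.sum_add_distrib, add_div]

theorem ev_sub (w f g : α → ℝ) : ev w (fun ω => f ω - g ω) = ev w f - ev w g := by
  simp only [ev, mul_sub, Finset.sum_sub_distrib, sub_div]

theorem ev_const_mul (w g : α → ℝ) (c : ℝ) : ev w (fun ω => c * g ω) = c * ev w g := by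
  simp only [ev, ← mul_div_assoc, Finset.mul_sum]
  congr 1
  exact Finset.sum_congr rfl fun _ _ => by ring

theorem ev_const {w : α → ℝ} (h : 0 < ∑ ω, w ω) (c : ℝ) : ev w (fun _ => c) = c := by
  rw [ev, ← Finset.sum_mul, mul_div_right_comm, div_self h.ne', one_mul]

theorem ev_sum {ι : Type*} (s : Finset ι) (w : α → ℝ) (g : ι → α → ℝ) :
    ev w (fun ω => ∑ i ∈ s, g i ω) = ∑ i ∈ s, ev w (g i) := by
  simp only [ev, Finset.mul_sum, ← Finset.sum_div]
  rw [Finset.sum_comm]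

theorem ev_mono {w f g : α → ℝ} (hw : ∀ ω, 0 ≤ w ω) (h : ∀ ω, w ω ≠ 0 → f ω ≤ g ω) :
    ev w f ≤ ev w g := by
  refine div_le_div_of_nonneg_right (Finset.sum_le_sum fun ω _ => ?_)
    (Finset.sum_nonneg fun ω _ => hw ω)
  by_cases h0 : w ω = 0
  · simp [h0]
  · exact mul_le_mul_of_nonneg_left (h ω h0) (hw ω)

theorem ev_congr {w f g : α → ℝ} (h : ∀ ω, w ω ≠ 0 → f ω = g ω) : ev w f = ev w g := by
  unfold ev
  congr 1
  refine Finset.sum_congr rfl fun ω _ => ?_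
  by_cases h0 : w ω = 0
  · simp [h0]
  · rw [h ω h0]

theorem ev_nonneg {w g : α → ℝ} (hw : ∀ ω, 0 ≤ w ω) (h : ∀ ω, 0 ≤ g ω) : 0 ≤ ev w g :=
  div_nonneg (Finset.sum_nonneg fun ω _ => mul_nonneg (hw ω) (h ω))
    (Finset.sum_nonneg fun ω _ => hw ω)

/-- The covariance of `f` and `g` under the probability measure proportional to `w`. -/
noncomputable def cov (w f g : α → ℝ) : ℝ := ev w (fun ω => f ω * g ω) - ev w f * ev w g

variable [DistribLattice α]

/-- Holley's comparison of two weights. -/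
theorem ev_le_ev_of_holley {v w g : α → ℝ} (hv : ∀ ω, 0 ≤ v ω) (hw : ∀ ω, 0 ≤ w ω)
    (hv' : 0 < ∑ ω, v ω) (hw' : 0 < ∑ ω, w ω) (hg : Monotone g)
    (h : ∀ a b, v a * w b ≤ v (a ⊓ b) * w (a ⊔ b)) : ev v g ≤ ev w g := by
  -- `holley` needs a nonnegative function and weights of equal total mass, hence the shift by a
  -- lower bound and the normalization.
  obtain ⟨c, hc⟩ : ∃ c, ∀ ω, c ≤ g ω := by
    obtain ⟨c, hc⟩ := (Set.finite_range g).bddBelow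
    exact ⟨c, fun ω => hc ⟨ω, rfl⟩⟩
  have key := holley (μ := fun ω => g ω - c) (f := fun ω => v ω / ∑ ω, v ω)
    (g := fun ω => w ω / ∑ ω, w ω) (fun ω => sub_nonneg.2 (hc ω))
    (fun ω => div_nonneg (hv ω) hv'.le) (fun ω => div_nonneg (hw ω) hw'.le)
    (fun a b hab => sub_le_sub_right (hg hab) c)
    (by rw [← Finset.sum_div, ← Finset.sum_div, div_self hv'.ne', div_self hw'.ne'])
    (fun a b => by
      rw [div_mul_div_comm, div_mul_div_comm]
      exact div_le_div_of_nonneg_right (h a b) (mul_pos hv' hw').le)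
  have e : ∀ u : α → ℝ, 0 < ∑ ω, u ω →
      ∑ ω, (g ω - c) * (u ω / ∑ ω, u ω) = ev u g - c := by
    intro u hu
    have h1 : ev u g - c = ev u (fun ω => g ω - c) := by rw [ev_sub, ev_const hu]
    rw [h1, ev, Finset.sum_div]
    exact Finset.sum_congr rfl fun _ _ => by ring
  rw [e v hv', e w hw'] at key
  linarith

/-- Positive association of log-supermodular weights. -/
theorem cov_nonneg {w f g : α → ℝ} (hw : ∀ ω, 0 ≤ w ω) (hw' : 0 < ∑ ω, w ω)
    (h : ∀ a b, w a * w b ≤ w (a ⊓ b) * w (a ⊔ b)) (hf : Monotone f) (hg : Monotone g) :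
    0 ≤ cov w f g := by
  -- `fkg` needs nonnegative functions; shifting `f` and `g` by constants leaves the covariance
  -- unchanged.
  have lower : ∀ k : α → ℝ, ∃ c, ∀ ω, c ≤ k ω := fun k => by
    obtain ⟨c, hc⟩ := (Set.finite_range k).bddBelow
    exact ⟨c, fun ω => hc ⟨ω, rfl⟩⟩
  obtain ⟨a, ha⟩ := lower f
  obtain ⟨b, hb⟩ := lower g
  have key := fkg (μ := w) (f := fun ω => f ω - a) (g := fun ω => g ω - b) hw
    (fun ω => sub_nonneg.2 (ha ω))
    (fun ω => sub_nonneg.2 (hb ω)) (fun _ _ hxy => sub_le_sub_right (hf hxy) a)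
    (fun _ _ hxy => sub_le_sub_right (hg hxy) b) h
  have h1 : ev w (fun ω => f ω - a) * ev w (fun ω => g ω - b) ≤
      ev w (fun ω => (f ω - a) * (g ω - b)) := by
    rw [ev, ev, ev, div_mul_div_comm, div_le_div_iff₀ (mul_pos hw' hw') hw']
    nlinarith [mul_le_mul_of_nonneg_right key hw'.le]
  have h2 : ev w (fun ω => (f ω - a) * (g ω - b)) =
      ev w (fun ω => f ω * g ω) - b * ev w f - a * ev w g + a * b := by
    have h3 : ev w (fun ω => f ω * g ω - b * f ω - a * g ω + a * b) =
        ev w (fun ω => f ω * g ω) - b * ev w f - a * ev w g + a * b := by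
      rw [ev_add, ev_sub, ev_sub, ev_const_mul, ev_const_mul, ev_const hw']
    rw [← h3]
    exact ev_congr fun ω _ => by ring
  rw [h2, ev_sub, ev_sub, ev_const hw', ev_const hw'] at h1
  unfold cov
  nlinarith

end Expectation

/-! ### The state of an edge -/

section OpenIndicator

variable {E : Type*}

/-- The indicator function of the event that `e` is open. -/
def isOpenInd (e : E) : (E → Bool) → ℝ := fun ω => if ω e = true then 1 else 0

theorem isOpenInd_mono (e : E) : Monotone (isOpenInd e) := by
  intro a b hab
  have := hab e
  unfold isOpenInd
  split_ifs with h1 h2 h2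
  · exact le_rfl
  · exact absurd (this h1) h2
  · exact zero_le_one
  · exact le_rfl

theorem isOpenInd_nonneg (e : E) (ω : E → Bool) : 0 ≤ isOpenInd e ω := by
  unfold isOpenInd; split_ifs <;> norm_num

theorem isOpenInd_le_one (e : E) (ω : E → Bool) : isOpenInd e ω ≤ 1 := by
  unfold isOpenInd; split_ifs <;> norm_num

end OpenIndicator

/-! ### Conditioning on the states of finitely many edges -/

section Conditioning

variable {E : Type*} [Fintype E] [DecidableEq E]

/-- The weight `w` restricted to the configurations that coincide with `y` on `S`. -/
def condWeight (w : (E → Bool) → ℝ) (S : Finset E) (y : E → Bool) : (E → Bool) → ℝ :=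
  fun ω => if ∀ e ∈ S, ω e = y e then w ω else 0

/-- The conditional expectation of `g` given that the configuration is `y` on `S`. -/
noncomputable def condEv (w : (E → Bool) → ℝ) (S : Finset E) (y : E → Bool)
    (g : (E → Bool) → ℝ) : ℝ := ev (condWeight w S y) g

variable {w : (E → Bool) → ℝ}

theorem condWeight_nonneg (hw : ∀ ω, 0 < w ω) (S : Finset E) (y ω : E → Bool) :
    0 ≤ condWeight w S y ω := by
  unfold condWeight; split_ifs; exacts [(hw ω).le, le_rfl]

theorem condWeight_ne_zero {S : Finset E} {y ω : E → Bool} (h : condWeight w S y ω ≠ 0) :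
    ∀ e ∈ S, ω e = y e := by
  by_contra h'; exact h (if_neg h')

theorem sum_condWeight_pos (hw : ∀ ω, 0 < w ω) (S : Finset E) (y : E → Bool) :
    0 < ∑ ω, condWeight w S y ω := by
  refine Finset.sum_pos' (fun ω _ => condWeight_nonneg hw S y ω) ⟨y, Finset.mem_univ y, ?_⟩
  rw [condWeight, if_pos fun _ _ => rfl]; exact hw y

theorem condWeight_congr {S : Finset E} {y y' : E → Bool} (h : ∀ e ∈ S, y e = y' e) :
    condWeight w S y = condWeight w S y' := by
  funext ω
  refine if_congr ?_ rfl rfl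
  exact forall₂_congr fun e he => by rw [h e he]

theorem condEv_empty (y : E → Bool) (g : (E → Bool) → ℝ) : condEv w ∅ y g = ev w g := by
  unfold condEv
  congr 1
  funext ω
  simp [condWeight]

/-- Holley's criterion survives the two conditionings: if `a` agrees with `y` and `b` with `y' ≥ y`
on `S`, then `a ⊓ b` agrees with `y` and `a ⊔ b` with `y'`. In all other cases the left-hand side
vanishes. -/
theorem condEv_mono (hw : ∀ ω, 0 < w ω) (h : ∀ a b, w a * w b ≤ w (a ⊓ b) * w (a ⊔ b))
    (S : Finset E) {g : (E → Bool) → ℝ} (hg : Monotone g) : Monotone (condEv w S · g) := by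
  intro y y' hy
  refine ev_le_ev_of_holley (condWeight_nonneg hw S y) (condWeight_nonneg hw S y')
    (sum_condWeight_pos hw S y) (sum_condWeight_pos hw S y') hg fun a b => ?_
  by_cases ha : ∀ e ∈ S, a e = y e
  · by_cases hb : ∀ e ∈ S, b e = y' e
    · have h1 : ∀ e ∈ S, (a ⊓ b) e = y e := fun e he => by
        rw [Pi.inf_apply, ha e he, hb e he]; exact inf_eq_left.2 (hy e)
      have h2 : ∀ e ∈ S, (a ⊔ b) e = y' e := fun e he => by
        rw [Pi.sup_apply, ha e he, hb e he]; exact sup_eq_right.2 (hy e)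
      simp only [condWeight, if_pos ha, if_pos hb, if_pos h1, if_pos h2]
      exact h a b
    · rw [show condWeight w S y' b = 0 from if_neg hb, mul_zero]
      exact mul_nonneg (condWeight_nonneg hw _ _ _) (condWeight_nonneg hw _ _ _)
  · rw [show condWeight w S y a = 0 from if_neg ha, zero_mul]
    exact mul_nonneg (condWeight_nonneg hw _ _ _) (condWeight_nonneg hw _ _ _)

/-- The tower property. -/
theorem ev_condEv (hw : ∀ ω, 0 < w ω) (S : Finset E) (g : (E → Bool) → ℝ) :
    ev w (condEv w S · g) = ev w g := by
  unfold ev condEv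
  congr 1
  -- "Agreeing on `S`" is symmetric and agreeing configurations have the same conditional
  -- normalization, so the double sum can be exchanged.
  have h1 : ∀ y, w y * ev (condWeight w S y) g =
      ∑ ω, w ω * g ω * (condWeight w S ω y / ∑ η, condWeight w S ω η) := by
    intro y
    rw [ev, ← mul_div_assoc, Finset.mul_sum, Finset.sum_div]
    refine Finset.sum_congr rfl fun ω _ => ?_
    by_cases hc : ∀ e ∈ S, ω e = y e
    · rw [condWeight_congr hc, ← condWeight_congr hc]
      have h2 : condWeight w S ω y = w y := if_pos fun e he => (hc e he).symm
      have h3 : condWeight w S y ω = w ω := if_pos hc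
      rw [← condWeight_congr hc] at h3
      rw [h2, h3]; ring
    · have h2 : condWeight w S ω y = 0 := if_neg fun h => hc fun e he => (h e he).symm
      have h3 : condWeight w S y ω = 0 := if_neg hc
      rw [h2, h3]; ring
  rw [Finset.sum_congr rfl fun y _ => h1 y, Finset.sum_comm]
  refine Finset.sum_congr rfl fun ω _ => ?_
  rw [← Finset.mul_sum, ← Finset.sum_div, div_self (sum_condWeight_pos hw S ω).ne', mul_one]

theorem condWeight_split {S : Finset E} {e : E} (he : e ∉ S) (y ω : E → Bool) :
    condWeight w S y ω = condWeight w (insert e S) (Function.update y e true) ω +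
      condWeight w (insert e S) (Function.update y e false) ω := by
  have h1 : ∀ b, (∀ i ∈ insert e S, ω i = Function.update y e b i) ↔
      ω e = b ∧ ∀ i ∈ S, ω i = y i := by
    intro b
    rw [Finset.forall_mem_insert, Function.update_self]
    refine and_congr_right fun _ => forall₂_congr fun i hi => ?_
    rw [Function.update_of_ne (fun h : i = e => he (h ▸ hi))]
  simp only [condWeight, h1]
  cases ω e <;> simp

theorem condEv_isOpenInd_mem_Icc (hw : ∀ ω, 0 < w ω) (S : Finset E) (e : E) (y : E → Bool) :
    condEv w S y (isOpenInd e) ∈ Set.Icc 0 1 :=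
  ⟨ev_nonneg (condWeight_nonneg hw S y) (isOpenInd_nonneg e), by
    rw [← ev_const (sum_condWeight_pos hw S y) 1]
    exact ev_mono (condWeight_nonneg hw S y) fun ω _ => isOpenInd_le_one e ω⟩

/-- Conditioning on the state of one more edge. -/
theorem condEv_split (hw : ∀ ω, 0 < w ω) {S : Finset E} {e : E} (he : e ∉ S) (y : E → Bool)
    (g : (E → Bool) → ℝ) :
    condEv w S y g =
      condEv w S y (isOpenInd e) * condEv w (insert e S) (Function.update y e true) g +
      (1 - condEv w S y (isOpenInd e)) *
        condEv w (insert e S) (Function.update y e false) g := by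
  have p1 := sum_condWeight_pos hw (insert e S) (Function.update y e true)
  have p0 := sum_condWeight_pos hw (insert e S) (Function.update y e false)
  have h1 : ∑ ω, condWeight w S y ω * isOpenInd e ω =
      ∑ ω, condWeight w (insert e S) (Function.update y e true) ω := by
    refine Finset.sum_congr rfl fun ω _ => ?_
    rw [condWeight_split he, isOpenInd]
    by_cases ho : ω e = true
    · have : condWeight w (insert e S) (Function.update y e false) ω = 0 :=
        if_neg fun h => by simpa [ho] using h e (Finset.mem_insert_self e S)
      rw [this, if_pos ho]; ring
    · have : condWeight w (insert e S) (Function.update y e true) ω = 0 :=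
        if_neg fun h => ho (by simpa using h e (Finset.mem_insert_self e S))
      rw [this, if_neg ho]; ring
  unfold condEv ev
  rw [h1]
  simp only [condWeight_split he, add_mul, Finset.sum_add_distrib]
  field_simp
  ring

/-- The conditional covariance of `f` with the state of an edge. -/
theorem condEv_mul_isOpenInd (hw : ∀ ω, 0 < w ω) {S : Finset E} {e : E} (he : e ∉ S)
    (y : E → Bool) (f : (E → Bool) → ℝ) :
    condEv w S y (fun ω => f ω * isOpenInd e ω) =
      condEv w S y (isOpenInd e) * condEv w (insert e S) (Function.update y e true) f := by
  rw [condEv_split hw he y]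
  have h1 : condEv w (insert e S) (Function.update y e true) (fun ω => f ω * isOpenInd e ω) =
      condEv w (insert e S) (Function.update y e true) f := by
    refine ev_congr fun ω h => ?_
    have := condWeight_ne_zero h e (Finset.mem_insert_self e S)
    simp only [Function.update_self] at this
    simp [isOpenInd, this]
  have h0 : condEv w (insert e S) (Function.update y e false) (fun ω => f ω * isOpenInd e ω) =
      0 := by
    rw [← ev_const (sum_condWeight_pos hw (insert e S) (Function.update y e false)) 0]
    refine ev_congr fun ω h => ?_
    have := condWeight_ne_zero h e (Finset.mem_insert_self e S)
    simp only [Function.update_self] at this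
    simp [isOpenInd, this]
  rw [h1, h0]; ring

theorem condEv_of_eqOn (hw : ∀ ω, 0 < w ω) {S : Finset E} {y : E → Bool}
    {g : (E → Bool) → ℝ} {c : ℝ} (h : ∀ ω, (∀ e ∈ S, ω e = y e) → g ω = c) :
    condEv w S y g = c := by
  rw [← ev_const (sum_condWeight_pos hw S y) c]
  exact ev_congr fun ω h' => h ω (condWeight_ne_zero h')

end Conditioning

/-! ### The OSSS inequality for monotone measures -/

section DecisionTree

/-- The expectation of a function on `{0,1}²` under the monotone coupling of two Bernoulli
variables of parameters `α` and `β`; the arguments are the values at `11`, `10`, `01`, `00`. -/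
noncomputable def coupled (α β a11 a10 a01 a00 : ℝ) : ℝ :=
  min α β * a11 + (α - min α β) * a10 + (β - min α β) * a01 + (1 - α - β + min α β) * a00

theorem coupled_self (α a11 a10 a01 a00 : ℝ) :
    coupled α α a11 a10 a01 a00 = α * a11 + (1 - α) * a00 := by
  unfold coupled; rw [min_self]; ring

/-- Raising the second parameter from `β` to `β'` only moves mass from `10` to `11` and from `00` to
`01`, which is favourable by `h1` and `h0`. -/
theorem coupled_mono {α β β' a11 a10 a01 a00 b11 b10 b01 b00 : ℝ} (hα : α ∈ Set.Icc (0 : ℝ) 1)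
    (hβ : β ∈ Set.Icc (0 : ℝ) 1) (hββ' : β ≤ β')
    (h11 : a11 ≤ b11) (h10 : a10 ≤ b10) (h01 : a01 ≤ b01) (h00 : a00 ≤ b00)
    (h1 : b10 ≤ b11) (h0 : b00 ≤ b01) :
    coupled α β a11 a10 a01 a00 ≤ coupled α β' b11 b10 b01 b00 := by
  have hm0 : 0 ≤ min α β := le_min hα.1 hβ.1
  have hm1 : min α β ≤ α := min_le_left _ _
  have hm2 : min α β ≤ β := min_le_right _ _
  have hm3 : 0 ≤ 1 - α - β + min α β := by
    rcases min_cases α β with ⟨h, _⟩ | ⟨h, _⟩ <;> rw [h]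
    · linarith [hβ.2]
    · linarith [hα.2]
  have hm4 : min α β ≤ min α β' := min_le_min_left α hββ'
  have hm5 : β - min α β ≤ β' - min α β' := by
    rcases min_cases α β with ⟨h, _⟩ | ⟨h, _⟩ <;>
      rcases min_cases α β' with ⟨h', _⟩ | ⟨h', _⟩ <;> rw [h, h'] <;> linarith
  have s1 : coupled α β a11 a10 a01 a00 ≤ coupled α β b11 b10 b01 b00 := by
    unfold coupled
    have := sub_nonneg.2 hm1
    have := sub_nonneg.2 hm2
    gcongr
  have s2 : coupled α β' b11 b10 b01 b00 - coupled α β b11 b10 b01 b00 =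
      (min α β' - min α β) * (b11 - b10) +
        ((β' - min α β') - (β - min α β)) * (b01 - b00) := by
    unfold coupled; ring
  have := mul_nonneg (sub_nonneg.2 hm4) (sub_nonneg.2 h1)
  have := mul_nonneg (sub_nonneg.2 hm5) (sub_nonneg.2 h0)
  linarith

/-- The error made when the coupled variables are replaced by independent ones. -/
theorem coupled_le_indep {α β a11 a10 a01 a00 k : ℝ} (hα : α ∈ Set.Icc (0 : ℝ) 1)
    (hβ : β ∈ Set.Icc (0 : ℝ) 1) (h0 : a00 ≤ a01) (hk : 0 ≤ k) (h1 : a11 - a10 ≤ k) :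
    coupled α β a11 a10 a01 a00 ≤
      α * (β * a11 + (1 - β) * a10) + (1 - α) * (β * a01 + (1 - β) * a00) +
        β * (1 - β) * k := by
  -- The two laws on `{0,1}²` have the same marginals, so they differ by a multiple of the
  -- alternating sum; the factor is the covariance of the coupled pair.
  have s : coupled α β a11 a10 a01 a00 -
      (α * (β * a11 + (1 - β) * a10) + (1 - α) * (β * a01 + (1 - β) * a00)) =
      (min α β - α * β) * ((a11 - a10) - (a01 - a00)) := by
    unfold coupled; ring
  have hm : 0 ≤ min α β - α * β := by
    rcases min_cases α β with ⟨h, _⟩ | ⟨h, _⟩ <;> rw [h]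
    · nlinarith [hα.1, hβ.2]
    · nlinarith [hβ.1, hα.2]
  -- The covariance is bounded by the variance of the second variable alone. This produces, in the
  -- induction, a conditional covariance in which `α` no longer appears.
  have hm' : min α β - α * β ≤ β * (1 - β) := by
    rcases min_cases α β with ⟨h, h'⟩ | ⟨h, h'⟩ <;> rw [h]
    · nlinarith [hβ.1, hβ.2]
    · nlinarith [hβ.1, hβ.2]
  have : (min α β - α * β) * ((a11 - a10) - (a01 - a00)) ≤ (min α β - α * β) * k :=
    mul_le_mul_of_nonneg_left (by linarith) hm
  have := mul_le_mul_of_nonneg_right hm' hk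
  linarith

variable {E : Type*} [Fintype E] [DecidableEq E] {w : (E → Bool) → ℝ}

/-- Meaning of `Φ`: let `X` follow the law conditioned on `x` on `S`, and `Y` the law conditioned on
`y` on `S`, where the edges are revealed in the order dictated by `X` and each revealed pair is
monotonically coupled. Then `Φ y` is the expectation of `f(X) f(Y)`. For `y = x` the two copies
coincide, hence the second moment. When `y` is averaged over `w`, the quantity `ev w Φ - ev w f *
condEv w S x f` is the covariance left between `f(X)` and `f(Y)`: it vanishes once `f` is
determined, and each revealed edge adds at most its covariance with `f`. Monotonicity of `Φ` and of
`condEv w S · f - Φ` (the expectation of `(1 - f(X)) f(Y)`) is what controls the cost of making a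
coupled pair independent. The induction is on the number of unrevealed edges. -/
theorem osss_induction (hw : ∀ ω, 0 < w ω) (hw' : ∀ a b, w a * w b ≤ w (a ⊓ b) * w (a ⊔ b))
    {f : (E → Bool) → ℝ} (hf : Monotone f) (hf01 : ∀ ω, f ω ∈ Set.Icc 0 1)
    {R : E → (E → Bool) → ℝ} (hR : ∀ e ω, 0 ≤ R e ω)
    (h : ∀ (S : Finset E) (x : E → Bool), (∀ ω, (∀ e ∈ S, ω e = x e) → f ω = f x) ∨
      ∃ e ∉ S, ∀ ω, (∀ e ∈ S, ω e = x e) → R e ω = 1) (n : ℕ) :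
    ∀ S : Finset E, Sᶜ.card = n → ∀ x : E → Bool, ∃ Φ : (E → Bool) → ℝ,
      (∀ y y', (∀ e ∈ S, y e = y' e) → Φ y = Φ y') ∧
      Φ x = condEv w S x (fun ω => f ω * f ω) ∧ Monotone Φ ∧
      Monotone (fun y => condEv w S y f - Φ y) ∧
      ev w Φ - ev w f * condEv w S x f ≤
        ∑ e ∈ Sᶜ, condEv w S x (R e) * cov w f (isOpenInd e) := by
  have hwsum : 0 < ∑ ω, w ω :=
    Finset.sum_pos (fun ω _ => hw ω) ⟨fun _ => true, Finset.mem_univ _⟩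
  have hcov : ∀ e, 0 ≤ cov w f (isOpenInd e) := fun e =>
    cov_nonneg (fun ω => (hw ω).le) hwsum hw' hf (isOpenInd_mono e)
  -- Leaf of the tree: `f(X)` is the constant `f x`, so `Φ y` is `f x` times the conditional
  -- expectation of `f` given `y`, and no covariance is left. Here `0 ≤ f x ≤ 1` gives both
  -- monotonicities.
  have hleaf : ∀ (S : Finset E) (x : E → Bool), (∀ ω, (∀ e ∈ S, ω e = x e) → f ω = f x) →
      ∃ Φ : (E → Bool) → ℝ, (∀ y y', (∀ e ∈ S, y e = y' e) → Φ y = Φ y') ∧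
      Φ x = condEv w S x (fun ω => f ω * f ω) ∧ Monotone Φ ∧
      Monotone (fun y => condEv w S y f - Φ y) ∧
      ev w Φ - ev w f * condEv w S x f ≤
        ∑ e ∈ Sᶜ, condEv w S x (R e) * cov w f (isOpenInd e) := by
    intro S x hx
    have hm := condEv_mono hw hw' S hf
    refine ⟨fun y => f x * condEv w S y f, fun y y' hy => ?_, ?_, ?_, ?_, ?_⟩
    · simp only [condEv, condWeight_congr hy]
    · dsimp only
      rw [condEv_of_eqOn hw hx, condEv_of_eqOn hw (c := f x * f x)]
      intro ω hω
      rw [hx ω hω]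
    · intro y y' hy
      exact mul_le_mul_of_nonneg_left (hm hy) (hf01 x).1
    · intro y y' hy
      have := mul_le_mul_of_nonneg_left (hm hy) (sub_nonneg.2 (hf01 x).2)
      dsimp only at this ⊢
      linarith
    · rw [ev_const_mul, ev_condEv hw, condEv_of_eqOn hw hx, mul_comm, sub_self]
      exact Finset.sum_nonneg fun e _ =>
        mul_nonneg (ev_nonneg (condWeight_nonneg hw S x) (hR e)) (hcov e)
  induction n with
  | zero =>
    intro S hS x
    refine hleaf S x fun ω hω => congrArg f (funext fun e => hω e ?_)
    by_contra he
    have : e ∈ Sᶜ := Finset.mem_compl.2 he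
    simp [Finset.card_eq_zero.1 hS] at this
  | succ n ih =>
    intro S hS x
    rcases h S x with hx | ⟨e, heS, hRe⟩
    · exact hleaf S x hx
    have hS' : (insert e S)ᶜ.card = n := by
      have h1 : e ∈ Sᶜ := Finset.mem_compl.2 heS
      rw [Finset.compl_insert, Finset.card_erase_of_mem h1, hS]; rfl
    obtain ⟨Φ1, d1, x1, m1, c1, i1⟩ := ih _ hS' (Function.update x e true)
    obtain ⟨Φ0, d0, x0, m0, c0, i0⟩ := ih _ hS' (Function.update x e false)
    set α := condEv w S x (isOpenInd e) with hα
    have hαm : α ∈ Set.Icc 0 1 := condEv_isOpenInd_mem_Icc hw S e x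
    have hβm := condEv_isOpenInd_mem_Icc hw S e
    have hβmono := condEv_mono hw hw' S (isOpenInd_mono e)
    have up : ∀ {y y' : E → Bool}, y ≤ y' → ∀ b,
        Function.update y e b ≤ Function.update y' e b := by
      intro y y' hy b i
      by_cases hi : i = e
      · subst hi; simp
      · simpa [hi] using hy i
    have up' : ∀ y : E → Bool, Function.update y e false ≤ Function.update y e true := by
      intro y i
      by_cases hi : i = e
      · subst hi; simp
      · simp [hi]
    have agree : ∀ {y y' : E → Bool}, (∀ i ∈ S, y i = y' i) → ∀ b,
        ∀ i ∈ insert e S, Function.update y e b i = Function.update y' e b i := by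
      intro y y' hy b i hi
      by_cases hie : i = e
      · subst hie; simp
      · simpa [hie] using hy i (Finset.mem_of_mem_insert_of_ne hi hie)
    set H : (E → Bool) → ℝ := fun y => condEv w (insert e S) y f with hH
    have mH : Monotone H := condEv_mono hw hw' (insert e S) hf
    -- The edge `e` is revealed in both copies: `X` chooses between `Φ1` and `Φ0`, `Y` between the
    -- two updates of `y`.
    let Φ : (E → Bool) → ℝ := fun y => coupled α (condEv w S y (isOpenInd e))
      (Φ1 (Function.update y e true)) (Φ1 (Function.update y e false))
      (Φ0 (Function.update y e true)) (Φ0 (Function.update y e false))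
    have tower : ∀ g : (E → Bool) → ℝ, (∀ y y', (∀ i ∈ insert e S, y i = y' i) → g y = g y') →
        ∀ y, condEv w S y g = condEv w S y (isOpenInd e) * g (Function.update y e true) +
          (1 - condEv w S y (isOpenInd e)) * g (Function.update y e false) := by
      intro g hg y
      rw [condEv_split hw heS, condEv_of_eqOn hw (fun ω hω => hg ω _ hω),
        condEv_of_eqOn hw (fun ω hω => hg ω _ hω)]
    refine ⟨Φ, fun y y' hy => ?_, ?_, ?_, ?_, ?_⟩
    · simp only [Φ, condEv, condWeight_congr hy, d1 _ _ (agree hy _), d0 _ _ (agree hy _)]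
    · simp only [Φ]
      rw [← hα, coupled_self, x1, x0, ← condEv_split hw heS]
    · intro y y' hy
      exact coupled_mono hαm (hβm y) (hβmono hy) (m1 (up hy _)) (m1 (up hy _)) (m0 (up hy _))
        (m0 (up hy _)) (m1 (up' _)) (m0 (up' _))
    -- The conditional expectation of `f` depends only on the second copy, so subtracting `Φ`
    -- preserves the coupled form and `coupled_mono` applies again.
    · have key : ∀ y, condEv w S y f - Φ y = coupled α (condEv w S y (isOpenInd e))
          (H (Function.update y e true) - Φ1 (Function.update y e true))
          (H (Function.update y e false) - Φ1 (Function.update y e false))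
          (H (Function.update y e true) - Φ0 (Function.update y e true))
          (H (Function.update y e false) - Φ0 (Function.update y e false)) := by
        intro y
        rw [condEv_split hw heS y f]
        simp only [Φ, coupled, hH]
        ring
      intro y y' hy
      simp only [key]
      exact coupled_mono hαm (hβm y) (hβmono hy) (c1 (up hy _)) (c1 (up hy _)) (c0 (up hy _))
        (c0 (up hy _)) (c1 (up' _)) (c0 (up' _))
    -- Replacing the coupled pair by an independent one costs at most the conditional covariance of
    -- `f` and `e` given `y` on `S`.
    · have hp : ∀ y, Φ y ≤ α * condEv w S y Φ1 + (1 - α) * condEv w S y Φ0 +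
          (condEv w S y (fun ω => f ω * isOpenInd e ω) -
            condEv w S y f * condEv w S y (isOpenInd e)) := by
        intro y
        rw [tower Φ1 d1, tower Φ0 d0, condEv_mul_isOpenInd hw heS, condEv_split hw heS y f]
        refine (coupled_le_indep hαm (hβm y) (m0 (up' y)) (sub_nonneg.2 (mH (up' y)))
          (by have := c1 (up' y); dsimp only [hH] at this ⊢; linarith)).trans (le_of_eq ?_)
        simp only [hH]; ring
      -- Law of total covariance: the average of the conditional covariances is at most `cov w f
      -- (isOpenInd e)`, since the covariance of the two conditional expectations, both increasing,
      -- is nonnegative by FKG.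
      have hE : ev w Φ ≤ α * ev w Φ1 + (1 - α) * ev w Φ0 + cov w f (isOpenInd e) := by
        refine (ev_mono (fun ω => (hw ω).le) fun y _ => hp y).trans ?_
        rw [ev_add, ev_add, ev_sub, ev_const_mul, ev_const_mul, ev_condEv hw, ev_condEv hw,
          ev_condEv hw]
        have := cov_nonneg (fun ω => (hw ω).le) hwsum hw' (condEv_mono hw hw' S hf) hβmono
        unfold cov at this ⊢
        rw [ev_condEv hw, ev_condEv hw] at this
        linarith
      -- The term of `e` has coefficient `1` because `e` is revealed at this node; the other terms
      -- split according to the state of `e`.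
      have hsum : ∑ i ∈ Sᶜ, condEv w S x (R i) * cov w f (isOpenInd i) =
          cov w f (isOpenInd e) +
          (α * (∑ i ∈ (insert e S)ᶜ, condEv w (insert e S) (Function.update x e true) (R i) *
            cov w f (isOpenInd i)) + (1 - α) * ∑ i ∈ (insert e S)ᶜ,
            condEv w (insert e S) (Function.update x e false) (R i) *
            cov w f (isOpenInd i)) := by
        rw [← Finset.add_sum_erase _ _ (Finset.mem_compl.2 heS), condEv_of_eqOn hw hRe, one_mul,
          ← Finset.compl_insert, Finset.mul_sum, Finset.mul_sum, ← Finset.sum_add_distrib]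
        congr 1
        refine Finset.sum_congr rfl fun i _ => ?_
        rw [condEv_split hw heS x (R i)]; ring
      rw [hsum, condEv_split hw heS x f]
      have := mul_le_mul_of_nonneg_left i1 hαm.1
      have := mul_le_mul_of_nonneg_left i0 (sub_nonneg.2 hαm.2)
      linarith

/-- The OSSS inequality for log-supermodular weights. The hypothesis `h` says that the values
of the edges can be revealed one by one, each revealed edge `e` satisfying `R e = 1`, until the
value of `f` is determined. -/
theorem osss (hw : ∀ ω, 0 < w ω) (hw' : ∀ a b, w a * w b ≤ w (a ⊓ b) * w (a ⊔ b))
    {f : (E → Bool) → ℝ} (hf : Monotone f) (hf01 : ∀ ω, f ω ∈ Set.Icc 0 1)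
    {R : E → (E → Bool) → ℝ} (hR : ∀ e ω, 0 ≤ R e ω)
    (h : ∀ (S : Finset E) (x : E → Bool), (∀ ω, (∀ e ∈ S, ω e = x e) → f ω = f x) ∨
      ∃ e ∉ S, ∀ ω, (∀ e ∈ S, ω e = x e) → R e ω = 1) :
    cov w f f ≤ ∑ e, ev w (R e) * cov w f (isOpenInd e) := by
  obtain ⟨Φ, d, hx, -, -, hle⟩ := osss_induction hw hw' hf hf01 hR h _ ∅ rfl fun _ => true
  have hwsum : 0 < ∑ ω, w ω :=
    Finset.sum_pos (fun ω _ => hw ω) ⟨fun _ => true, Finset.mem_univ _⟩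
  -- At the root nothing is revealed, so `Φ` is constant and the claim is about the full variance.
  have hΦ : ev w Φ = ev w (fun ω => f ω * f ω) := by
    rw [← condEv_empty (w := w) (fun _ => true) (fun ω => f ω * f ω), ← hx,
      ← ev_const hwsum (Φ fun _ => true)]
    exact ev_congr fun ω _ => d _ _ (by simp)
  simpa only [hΦ, condEv_empty, Finset.compl_empty] using! hle

end DecisionTree

/-! ### Dependence on the edge-weight: Russo's formula -/

section EdgeWeight

variable {E : Type*} [Fintype E] {κ : (E → Bool) → ℝ} {p : ℝ}

/-- The weight `p^{o(ω)} (1-p)^{c(ω)} κ(ω)`. -/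
def edgeWeight (p : ℝ) (κ : (E → Bool) → ℝ) (ω : E → Bool) : ℝ :=
  p ^ (Finset.univ.filter (ω · = true)).card *
    (1 - p) ^ (Finset.univ.filter (ω · = false)).card * κ ω

theorem edgeWeight_eq_prod (p : ℝ) (κ : (E → Bool) → ℝ) (ω : E → Bool) :
    edgeWeight p κ ω = (∏ e, if ω e = true then p else 1 - p) * κ ω := by
  rw [edgeWeight, Finset.prod_ite, Finset.prod_const, Finset.prod_const]
  simp

theorem edgeWeight_nonneg (hp : p ∈ Set.Icc (0 : ℝ) 1) (hκ : ∀ ω, 0 < κ ω) (ω : E → Bool) :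
    0 ≤ edgeWeight p κ ω :=
  mul_nonneg (mul_nonneg (pow_nonneg hp.1 _) (pow_nonneg (sub_nonneg.2 hp.2) _)) (hκ ω).le

theorem edgeWeight_pos (hp : p ∈ Set.Ioo (0 : ℝ) 1) (hκ : ∀ ω, 0 < κ ω) (ω : E → Bool) :
    0 < edgeWeight p κ ω :=
  mul_pos (mul_pos (pow_pos hp.1 _) (pow_pos (sub_pos.2 hp.2) _)) (hκ ω)

theorem edgeWeight_supermodular (hp : p ∈ Set.Icc (0 : ℝ) 1)
    (hκ' : ∀ a b, κ a * κ b ≤ κ (a ⊓ b) * κ (a ⊔ b)) (a b : E → Bool) :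
    edgeWeight p κ a * edgeWeight p κ b ≤ edgeWeight p κ (a ⊓ b) * edgeWeight p κ (a ⊔ b) := by
  simp only [edgeWeight_eq_prod]
  rw [mul_mul_mul_comm _ (κ a), mul_mul_mul_comm _ (κ (a ⊓ b)), ← Finset.prod_mul_distrib,
    ← Finset.prod_mul_distrib]
  have h1 : ∀ e : E, ((if a e = true then p else 1 - p) * if b e = true then p else 1 - p) =
      (if (a ⊓ b) e = true then p else 1 - p) * if (a ⊔ b) e = true then p else 1 - p := by
    intro e
    rw [Pi.inf_apply, Pi.sup_apply]
    cases a e <;> cases b e <;> simp [mul_comm]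
  simp only [h1]
  refine mul_le_mul_of_nonneg_left (hκ' a b) (Finset.prod_nonneg fun e _ => mul_nonneg ?_ ?_) <;>
  · split_ifs
    exacts [hp.1, sub_nonneg.2 hp.2]

/-- The logarithmic derivative is `o/p - c/(1-p)`, and `o + c` is the number of edges. -/
theorem hasDerivAt_edgeWeight (hp : p ∈ Set.Ioo (0 : ℝ) 1) (κ : (E → Bool) → ℝ) (ω : E → Bool) :
    HasDerivAt (fun t => edgeWeight t κ ω)
      (edgeWeight p κ ω * ((∑ e, isOpenInd e ω) - Fintype.card E * p) / (p * (1 - p))) p := by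
  have h0 := hp.1.ne'
  have h1 := (sub_pos.2 hp.2).ne'
  set a := (Finset.univ.filter (ω · = true)).card with ha
  set b := (Finset.univ.filter (ω · = false)).card with hb
  have hab : (Fintype.card E : ℝ) = a + b := by
    rw [← Finset.card_univ, ← Finset.card_filter_add_card_filter_not (ω · = true)]
    push_cast
    simp [ha, hb]
  have hsum : ∑ e, isOpenInd e ω = a := by simp [isOpenInd, ha]
  have hpow : ∀ (x : ℝ) (n : ℕ), x ≠ 0 → (n : ℝ) * x ^ (n - 1) = n * x ^ n / x := by
    intro x n hx
    cases n with
    | zero => simp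
    | succ n => rw [Nat.add_sub_cancel, pow_succ]; field_simp
  have d := (((hasDerivAt_id p).pow a).mul (((hasDerivAt_id p).const_sub 1).pow b)).mul_const (κ ω)
  refine (d.congr_deriv ?_).congr_of_eventuallyEq (Eventually.of_forall fun t => rfl)
  simp only [id, Pi.pow_apply, edgeWeight, ← ha, ← hb]
  rw [hpow _ _ h0, hpow _ _ h1, hsum, hab]
  field_simp
  ring

variable [DecidableEq E]

theorem sum_edgeWeight_pos (hp : p ∈ Set.Icc (0 : ℝ) 1) (hκ : ∀ ω, 0 < κ ω) :
    0 < ∑ ω, edgeWeight p κ ω := by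
  rcases hp.2.lt_or_eq with h | h
  · refine Finset.sum_pos' (fun ω _ => edgeWeight_nonneg hp hκ ω)
      ⟨fun _ => false, Finset.mem_univ _, ?_⟩
    simpa [edgeWeight] using mul_pos (pow_pos (sub_pos.2 h) _) (hκ _)
  · refine Finset.sum_pos' (fun ω _ => edgeWeight_nonneg hp hκ ω)
      ⟨fun _ => true, Finset.mem_univ _, ?_⟩
    simpa [edgeWeight, h] using hκ _

/-- Russo's formula in covariance form. Differentiating the quotient gives the covariance of `g`
with the logarithmic derivative of the weight, in which the constant `|E| p` cancels. -/
theorem hasDerivAt_ev_edgeWeight (hp : p ∈ Set.Ioo (0 : ℝ) 1) (hκ : ∀ ω, 0 < κ ω)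
    (g : (E → Bool) → ℝ) :
    HasDerivAt (fun t => ev (edgeWeight t κ) g)
      ((∑ e, cov (edgeWeight p κ) g (isOpenInd e)) / (p * (1 - p))) p := by
  have hZ := (sum_edgeWeight_pos (Set.Ioo_subset_Icc_self hp) hκ).ne'
  have dN := HasDerivAt.fun_sum (u := Finset.univ) fun (ω : E → Bool) _ =>
    (hasDerivAt_edgeWeight hp κ ω).mul_const (g ω)
  have dZ := HasDerivAt.fun_sum (u := Finset.univ) fun (ω : E → Bool) _ =>
    hasDerivAt_edgeWeight hp κ ω
  refine (dN.div dZ hZ).congr_deriv ?_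
  have h0 := hp.1.ne'
  have h1 := (sub_pos.2 hp.2).ne'
  set w := edgeWeight p κ with hw
  have hcov : ∑ e, cov w g (isOpenInd e) = ev w (fun ω => g ω * ∑ e, isOpenInd e ω) -
      ev w g * ev w (fun ω => ∑ e, isOpenInd e ω) := by
    simp only [cov, Finset.sum_sub_distrib, Finset.mul_sum, ev_sum]
  rw [hcov]
  unfold ev
  have e1 : ∑ ω, w ω * ((∑ e, isOpenInd e ω) - Fintype.card E * p) / (p * (1 - p)) * g ω =
      ((∑ ω, w ω * (g ω * ∑ e, isOpenInd e ω)) - Fintype.card E * p * ∑ ω, w ω * g ω) /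
        (p * (1 - p)) := by
    rw [Finset.mul_sum, ← Finset.sum_sub_distrib, Finset.sum_div]
    exact Finset.sum_congr rfl fun _ _ => by ring
  have e2 : ∑ ω, w ω * ((∑ e, isOpenInd e ω) - Fintype.card E * p) / (p * (1 - p)) =
      ((∑ ω, w ω * ∑ e, isOpenInd e ω) - Fintype.card E * p * ∑ ω, w ω) / (p * (1 - p)) := by
    rw [Finset.mul_sum, ← Finset.sum_sub_distrib, Finset.sum_div]
    exact Finset.sum_congr rfl fun _ _ => by ring
  rw [e1, e2]
  field_simp
  ring

theorem continuousOn_ev_edgeWeight (hκ : ∀ ω, 0 < κ ω) (g : (E → Bool) → ℝ) :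
    ContinuousOn (fun t => ev (edgeWeight t κ) g) (Set.Icc 0 1) := by
  refine ContinuousOn.div ?_ ?_ fun t ht => (sum_edgeWeight_pos ht hκ).ne' <;>
  · unfold edgeWeight
    fun_prop

theorem monotoneOn_ev_edgeWeight (hκ : ∀ ω, 0 < κ ω)
    (hκ' : ∀ a b, κ a * κ b ≤ κ (a ⊓ b) * κ (a ⊔ b)) {g : (E → Bool) → ℝ} (hg : Monotone g) :
    MonotoneOn (fun t => ev (edgeWeight t κ) g) (Set.Icc 0 1) := by
  refine monotoneOn_of_deriv_nonneg (convex_Icc 0 1) (continuousOn_ev_edgeWeight hκ g) ?_ ?_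
  · rw [interior_Icc]
    exact fun t ht => (hasDerivAt_ev_edgeWeight ht hκ g).differentiableAt.differentiableWithinAt
  · rw [interior_Icc]
    intro t ht
    rw [(hasDerivAt_ev_edgeWeight ht hκ g).deriv]
    have ht' := Set.Ioo_subset_Icc_self ht
    exact div_nonneg (Finset.sum_nonneg fun e _ => cov_nonneg (edgeWeight_nonneg ht' hκ)
      (sum_edgeWeight_pos ht' hκ) (edgeWeight_supermodular ht' hκ') hg (isOpenInd_mono e))
      (mul_nonneg ht.1.le (sub_nonneg.2 ht.2.le))

end EdgeWeight

/-! ### Supermodularity of the number of clusters -/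

section Clusters

/-- The functions that are constant on the classes of a setoid. -/
def classFunctions {V : Type*} (r : Setoid V) : Submodule ℝ (V → ℝ) where
  carrier := {g | ∀ x y, r x y → g x = g y}
  add_mem' := fun hf hg x y h => by simp [hf x y h, hg x y h]
  zero_mem' := fun _ _ _ => rfl
  smul_mem' := fun c g hg x y h => by simp [hg x y h]

/-- Turns the number of classes into a dimension, so that the supermodularity below follows from the
dimension formula for the sum and intersection of two subspaces. -/
theorem finrank_classFunctions {V : Type*} [Finite V] (r : Setoid V) :
    Module.finrank ℝ (classFunctions r) = Nat.card (Quotient r) := by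
  have := Fintype.ofFinite (Quotient r)
  let e : classFunctions r ≃ₗ[ℝ] (Quotient r → ℝ) :=
    { toFun := fun g c => Quotient.lift g.1 (fun x y h => g.2 x y h) c
      map_add' := fun f g => by
        funext c; induction c using Quotient.inductionOn; rfl
      map_smul' := fun a g => by
        funext c; induction c using Quotient.inductionOn; rfl
      invFun := fun h => ⟨fun x => h (Quotient.mk r x), fun x y hxy =>
        congrArg h (Quotient.sound (s := r) hxy)⟩
      left_inv := fun g => rfl
      right_inv := fun h => by
        funext c; induction c using Quotient.inductionOn; rfl }
  rw [e.finrank_eq, Module.finrank_pi, Nat.card_eq_fintype_card]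

/-- The number of classes is a supermodular function of the equivalence relation. -/
theorem card_quotient_supermodular {V : Type*} [Finite V] (r s : Setoid V) :
    Nat.card (Quotient r) + Nat.card (Quotient s) ≤
      Nat.card (Quotient (r ⊓ s)) + Nat.card (Quotient (r ⊔ s)) := by
  simp only [← finrank_classFunctions]
  rw [← Submodule.finrank_sup_add_finrank_inf_eq]
  have h1 : classFunctions r ⊔ classFunctions s ≤ classFunctions (r ⊓ s) :=
    sup_le (fun g hg x y h => hg x y h.1) (fun g hg x y h => hg x y h.2)
  have h2 : classFunctions r ⊓ classFunctions s ≤ classFunctions (r ⊔ s) := by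
    intro g hg x y h
    have : r ⊔ s ≤ Setoid.ker g := sup_le (fun _ _ h => hg.1 _ _ h) (fun _ _ h => hg.2 _ _ h)
    exact this h
  exact add_le_add (Submodule.finrank_mono h1) (Submodule.finrank_mono h2)

theorem card_quotient_anti {V : Type*} [Finite V] {r s : Setoid V} (h : r ≤ s) :
    Nat.card (Quotient s) ≤ Nat.card (Quotient r) := by
  simp only [← finrank_classFunctions]
  exact Submodule.finrank_mono fun g hg x y hxy => hg x y (h hxy)

variable {V : Type*} {G : SimpleGraph V}

theorem openGraph_adj {ω : Config G} {x y : V} :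
    (openGraph ω).Adj x y ↔ ∃ h : G.Adj x y, ω ⟨s(x, y), h⟩ = true := by
  rw [openGraph, SimpleGraph.fromEdgeSet_adj]
  exact ⟨fun h => h.1, fun h => ⟨h, h.1.ne⟩⟩

theorem openGraph_mono : Monotone (openGraph (G := G)) := by
  intro a b hab x y h
  rw [openGraph_adj] at h ⊢
  exact h.imp fun h ha => hab _ ha

/-- The clusters of `ω^ξ`, as an equivalence relation on the vertices. -/
def clusterSetoid (ω : Config G) (ξ : Setoid V) : Setoid V :=
  Relation.EqvGen.setoid fun x y => ξ x y ∨ (openGraph ω).Adj x y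

theorem clusterSetoid_le {ω : Config G} {ξ t : Setoid V} (h1 : ξ ≤ t)
    (h2 : ∀ x y, (openGraph ω).Adj x y → t x y) : clusterSetoid ω ξ ≤ t :=
  Setoid.eqvGen_le fun x y h => h.elim (fun h => h1 h) (h2 x y)

theorem clusterSetoid_of_boundary {ω : Config G} {ξ : Setoid V} {x y : V} (h : ξ x y) :
    clusterSetoid ω ξ x y := Relation.EqvGen.rel _ _ (Or.inl h)

theorem clusterSetoid_of_adj {ω : Config G} {ξ : Setoid V} {x y : V}
    (h : (openGraph ω).Adj x y) : clusterSetoid ω ξ x y := Relation.EqvGen.rel _ _ (Or.inr h)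

/-- Contracting the classes of `ξ` and then taking components amounts to generating one equivalence
relation on the original vertices, a form in which configurations are easier to compare. -/
theorem numClusters_eq_card (ω : Config G) (ξ : Setoid V) :
    numClusters ω ξ = Nat.card (Quotient (clusterSetoid ω ξ)) := by
  let f : V → (contract ω ξ).ConnectedComponent :=
    fun x => (contract ω ξ).connectedComponentMk (Quotient.mk ξ x)
  have hf : Function.Surjective f := by
    intro c
    induction c using SimpleGraph.ConnectedComponent.ind with | _ v
    induction v using Quotient.inductionOn with | _ x
    exact ⟨x, rfl⟩
  have hker : Setoid.ker f = clusterSetoid ω ξ := by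
    refine le_antisymm (fun x y hxy => ?_) (clusterSetoid_le (fun x y h => ?_) fun x y h => ?_)
    · have h1 : (contract ω ξ).Reachable (Quotient.mk ξ x) (Quotient.mk ξ y) :=
        SimpleGraph.ConnectedComponent.exact hxy
      let l : Quotient ξ → Quotient (clusterSetoid ω ξ) :=
        Quotient.map id fun a b h => clusterSetoid_of_boundary h
      have h2 : ∀ a b, (contract ω ξ).Reachable a b → l a = l b := by
        rintro a b ⟨W⟩
        induction W with
        | nil => rfl
        | cons hadj _ ih =>
          rw [← ih]
          obtain ⟨-, u, v, huv, rfl, rfl⟩ := hadj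
          exact Quotient.sound (clusterSetoid_of_adj huv)
      exact Quotient.exact (h2 _ _ h1)
    · have : Quotient.mk ξ x = Quotient.mk ξ y := Quotient.sound h
      exact congrArg (contract ω ξ).connectedComponentMk this
    -- An open edge inside one class becomes a loop, which the contracted simple graph drops.
    · by_cases hxy : Quotient.mk ξ x = Quotient.mk ξ y
      · exact congrArg (contract ω ξ).connectedComponentMk hxy
      · exact SimpleGraph.ConnectedComponent.sound
          (SimpleGraph.Adj.reachable ⟨hxy, x, y, h, rfl, rfl⟩)
  rw [numClusters, ← hker]
  exact (Nat.card_congr (Setoid.quotientKerEquivOfSurjective f hf)).symm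

/-- The cluster relation of `a ⊓ b` is finer than the meet of those of `a` and `b`, and that of `a ⊔
b` is finer than their join; finer relations have more classes. -/
theorem numClusters_supermodular [Finite V] (ξ : Setoid V) (a b : Config G) :
    numClusters a ξ + numClusters b ξ ≤ numClusters (a ⊓ b) ξ + numClusters (a ⊔ b) ξ := by
  simp only [numClusters_eq_card]
  refine (card_quotient_supermodular _ _).trans (add_le_add ?_ ?_)
  · refine card_quotient_anti (clusterSetoid_le (fun x y h => ?_) fun x y h => ?_)
    · exact ⟨clusterSetoid_of_boundary h, clusterSetoid_of_boundary h⟩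
    · exact ⟨clusterSetoid_of_adj (openGraph_mono inf_le_left h),
        clusterSetoid_of_adj (openGraph_mono inf_le_right h)⟩
  · refine card_quotient_anti (clusterSetoid_le (fun x y h => ?_) fun x y h => ?_)
    · exact (le_sup_left : clusterSetoid a ξ ≤ _) (clusterSetoid_of_boundary h)
    · obtain ⟨hG, h⟩ := openGraph_adj.1 h
      rw [Pi.sup_apply] at h
      rcases Bool.or_eq_true_iff.1 h with h | h
      · exact (le_sup_left : clusterSetoid a ξ ≤ _)
          (clusterSetoid_of_adj (openGraph_adj.2 ⟨hG, h⟩))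
      · exact (le_sup_right : clusterSetoid b ξ ≤ _)
          (clusterSetoid_of_adj (openGraph_adj.2 ⟨hG, h⟩))

theorem pow_numClusters_supermodular [Finite V] {q : ℝ} (hq : 1 ≤ q) (ξ : Setoid V)
    (a b : Config G) : q ^ numClusters a ξ * q ^ numClusters b ξ ≤
      q ^ numClusters (a ⊓ b) ξ * q ^ numClusters (a ⊔ b) ξ := by
  rw [← pow_add, ← pow_add]
  exact pow_le_pow_right₀ hq (numClusters_supermodular ξ a b)

open Classical in
theorem weight_eq_edgeWeight [Fintype V] (ξ : Setoid V) (p q : ℝ) :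
    weight (G := G) ξ p q = edgeWeight p (fun ω => q ^ numClusters ω ξ) := by
  funext ω
  simp only [weight, edgeWeight, numOpen, numClosed, Nat.card_eq_fintype_card,
    Fintype.card_subtype]

open Classical in
/-- The expectation of `g` under the random-cluster measure. -/
noncomputable def fkEv [Fintype V] (G : SimpleGraph V) (ξ : Setoid V) (p q : ℝ)
    (g : Config G → ℝ) : ℝ := ev (weight ξ p q) g

theorem fkEv_eq_ev [Fintype V] [Fintype G.edgeSet] [DecidableEq G.edgeSet] (ξ : Setoid V)
    (p q : ℝ) (g : Config G → ℝ) :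
    fkEv G ξ p q g = ev (edgeWeight p fun ω => q ^ numClusters ω ξ) g := by
  rw [fkEv, weight_eq_edgeWeight]
  congr!

/-- The indicator function of a set. -/
noncomputable def ind {α : Type*} (A : Set α) : α → ℝ := A.indicator 1

open Classical in
theorem finiteMeasure_real [Fintype V] (ξ : Setoid V) {p q : ℝ} (hp : p ∈ Set.Icc (0 : ℝ) 1)
    (hq : 0 < q) (A : Set (Config G)) :
    (finiteMeasure G ξ p q).real A = fkEv G ξ p q (ind A) := by
  have hw : ∀ ω : Config G, 0 ≤ weight ξ p q ω := fun ω =>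
    mul_nonneg (mul_nonneg (pow_nonneg hp.1 _) (pow_nonneg (sub_nonneg.2 hp.2) _))
      (pow_nonneg hq.le _)
  have hZ : 0 ≤ partitionFunction G ξ p q := Finset.sum_nonneg fun ω _ => hw ω
  rw [finiteMeasure, Measure.real, Measure.finsetSum_apply]
  simp only [Measure.smul_apply, smul_eq_mul, Measure.dirac_apply' _ A.toFinite.measurableSet]
  rw [ENNReal.toReal_sum fun ω _ => ENNReal.mul_ne_top ENNReal.ofReal_ne_top ?_]
  · rw [fkEv, ev, Finset.sum_div]
    refine Finset.sum_congr rfl fun ω _ => ?_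
    rw [ENNReal.toReal_mul, ENNReal.toReal_ofReal (div_nonneg (hw ω) hZ)]
    by_cases h : ω ∈ A
    · simp [ind, h, partitionFunction]
    · simp [ind, h]
  · by_cases h : ω ∈ A <;> simp [h]

end Clusters

/-! ### Restriction and extension along graph embeddings -/

section Pull

variable {V V' V'' : Type*} {G : SimpleGraph V} {G' : SimpleGraph V'} {G'' : SimpleGraph V''}

/-- The restriction of a configuration along a graph embedding. -/
def pull (φ : G ↪g G') (ω : Config G') : Config G := fun e => ω (φ.mapEdgeSet e)

theorem pull_mono (φ : G ↪g G') : Monotone (pull φ) := fun _ _ h e => h (φ.mapEdgeSet e)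

theorem openGraph_pull_adj {φ : G ↪g G'} {ω : Config G'} {u v : V} :
    (openGraph (pull φ ω)).Adj u v ↔ (openGraph ω).Adj (φ u) (φ v) := by
  rw [openGraph_adj, openGraph_adj]
  exact ⟨fun ⟨h, ho⟩ => ⟨φ.map_rel_iff.2 h, ho⟩, fun ⟨h, ho⟩ => ⟨φ.map_rel_iff.1 h, ho⟩⟩

theorem pull_pull (φ : G ↪g G') (ψ : G' ↪g G'') (χ : G ↪g G'') (h : ∀ v, ψ (φ v) = χ v)
    (ω : Config G'') : pull φ (pull ψ ω) = pull χ ω := by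
  have : χ = ψ.comp φ := by ext v; exact (h v).symm
  subst this
  funext ⟨e, he⟩
  induction e using Sym2.ind
  rfl

theorem reachable_of_pull {φ : G ↪g G'} {ω : Config G'} {u v : V}
    (h : (openGraph (pull φ ω)).Reachable u v) : (openGraph ω).Reachable (φ u) (φ v) :=
  h.map (⟨φ, fun h => openGraph_pull_adj.1 h⟩ : openGraph (pull φ ω) →g openGraph ω)

/-- A path that starts in the image of an embedding either ends there, or has to leave it. -/
theorem reachable_pull_or_exit {φ : G ↪g G'} {ω : Config G'} {u : V} {y : V'}
    (h : (openGraph ω).Reachable (φ u) y) :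
    (∃ v, φ v = y ∧ (openGraph (pull φ ω)).Reachable u v) ∨
      ∃ v, (openGraph (pull φ ω)).Reachable u v ∧ ∃ z, (∀ v', φ v' ≠ z) ∧
        (openGraph ω).Adj (φ v) z := by
  obtain ⟨W⟩ := h
  generalize hx : φ u = x at W
  induction W generalizing u with
  | nil => exact Or.inl ⟨u, hx, .refl _⟩
  | @cons a b c hab _ ih =>
    by_cases hb : ∃ v, φ v = b
    · obtain ⟨v, rfl⟩ := hb
      subst hx
      have huv := (openGraph_pull_adj.2 hab).reachable
      rcases ih rfl with ⟨v', h1, h2⟩ | ⟨v', h1, h2⟩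
      · exact Or.inl ⟨v', h1, huv.trans h2⟩
      · exact Or.inr ⟨v', huv.trans h1, h2⟩
    · subst hx
      exact Or.inr ⟨u, .refl _, b, fun v' h => hb ⟨v', h⟩, hab⟩

open Classical in
/-- The extension of a configuration along a graph embedding, the other edges being open. -/
noncomputable def push (φ : G ↪g G') (ω : Config G) : Config G' :=
  fun e' => if h : ∃ e, φ.mapEdgeSet e = e' then ω h.choose else true

theorem push_mapEdgeSet (φ : G ↪g G') (ω : Config G) (e : G.edgeSet) :
    push φ ω (φ.mapEdgeSet e) = ω e := by
  have h : ∃ e₁, φ.mapEdgeSet e₁ = φ.mapEdgeSet e := ⟨e, rfl⟩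
  rw [push, dif_pos h, φ.mapEdgeSet.injective h.choose_spec]

theorem pull_push (φ : G ↪g G') (ω : Config G) : pull φ (push φ ω) = ω :=
  funext fun e => push_mapEdgeSet φ ω e

theorem push_of_notMem (φ : G ↪g G') (ω : Config G) {e' : G'.edgeSet}
    (h : ∀ e, φ.mapEdgeSet e ≠ e') : push φ ω e' = true :=
  dif_neg fun ⟨e, he⟩ => h e he

theorem push_pull (φ : G ↪g G') (ω : Config G')
    (h : ∀ e', (∀ e, φ.mapEdgeSet e ≠ e') → ω e' = true) : push φ (pull φ ω) = ω := by
  funext e'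
  by_cases he : ∃ e, φ.mapEdgeSet e = e'
  · obtain ⟨e, rfl⟩ := he
    exact push_mapEdgeSet φ _ e
  · rw [push_of_notMem φ _ fun e h => he ⟨e, h⟩, h e' fun e h => he ⟨e, h⟩]

theorem openGraph_push_adj_of_notMem {φ : G ↪g G'} {ω : Config G} {u v : V'} (h : G'.Adj u v)
    (hv : ∀ b, φ b ≠ v) : (openGraph (push φ ω)).Adj u v := by
  rw [openGraph_adj]
  refine ⟨h, push_of_notMem φ ω fun e he => ?_⟩
  obtain ⟨e, hG⟩ := e
  induction e using Sym2.ind with | _ a b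
  have h1 : s(φ a, φ b) = s(u, v) := congrArg Subtype.val he
  rcases Sym2.eq_iff.1 h1 with ⟨-, h2⟩ | ⟨h2, -⟩
  · exact hv b h2
  · exact hv a h2

theorem openGraph_push_adj {φ : G ↪g G'} {ω : Config G} {u v : V} :
    (openGraph (push φ ω)).Adj (φ u) (φ v) ↔ (openGraph ω).Adj u v := by
  rw [← openGraph_pull_adj, pull_push]

/-! ### Comparison of random-cluster measures on two graphs -/

section Comparison

variable [Fintype V] [Fintype V']

theorem fkEv_mono {ξ : Setoid V} {p q : ℝ} (hp : p ∈ Set.Icc (0 : ℝ) 1) (hq : 0 < q)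
    {f g : Config G → ℝ} (h : ∀ ω, f ω ≤ g ω) : fkEv G ξ p q f ≤ fkEv G ξ p q g := by
  classical
  unfold fkEv
  rw [weight_eq_edgeWeight]
  exact ev_mono (edgeWeight_nonneg hp fun ω => pow_pos hq _) fun ω _ => h ω

theorem continuousOn_fkEv {ξ : Setoid V} {q : ℝ} (hq : 0 < q) (g : Config G → ℝ) :
    ContinuousOn (fun t => fkEv G ξ t q g) (Set.Icc 0 1) := by
  classical
  simp only [fkEv, weight_eq_edgeWeight]
  exact continuousOn_ev_edgeWeight (fun ω => pow_pos hq _) g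

-- The edges outside the image are all open, so they contribute the same factor for every `ω`, which
-- cancels after normalization.
open Classical in
theorem weight_push {φ : G ↪g G'} {ξ : Setoid V} {ξ' : Setoid V'} (p q : ℝ)
    (hk : ∀ ω : Config G, numClusters (push φ ω) ξ' = numClusters ω ξ) (ω : Config G) :
    weight ξ' p q (push φ ω) =
      p ^ (Finset.univ.map φ.mapEdgeSet)ᶜ.card * weight ξ p q ω := by
  rw [weight_eq_edgeWeight, weight_eq_edgeWeight, edgeWeight_eq_prod, edgeWeight_eq_prod, hk,
    ← Finset.prod_mul_prod_compl (Finset.univ.map φ.mapEdgeSet), Finset.prod_map]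
  have h1 : ∏ e' ∈ (Finset.univ.map φ.mapEdgeSet)ᶜ, (if push φ ω e' = true then p else 1 - p) =
      p ^ (Finset.univ.map φ.mapEdgeSet)ᶜ.card := by
    rw [← Finset.prod_const]
    refine Finset.prod_congr rfl fun e' he' => ?_
    rw [push_of_notMem φ ω fun e he => ?_, if_pos rfl]
    exact Finset.mem_compl.1 he' (Finset.mem_map.2 ⟨e, Finset.mem_univ _, he⟩)
  simp only [h1, push_mapEdgeSet]
  ring

/-- Opening all the edges outside the image of an embedding increases the measure. -/
theorem fkEv_pull_le {φ : G ↪g G'} {ξ : Setoid V} {ξ' : Setoid V'} {p q : ℝ} (hq : 1 ≤ q)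
    (hk : ∀ ω : Config G, numClusters (push φ ω) ξ' = numClusters ω ξ)
    (hp : p ∈ Set.Icc (0 : ℝ) 1) {g : Config G → ℝ} (hg : Monotone g) :
    fkEv G' ξ' p q (fun ω => g (pull φ ω)) ≤ fkEv G ξ p q g := by
  classical
  have hq0 : 0 < q := zero_lt_one.trans_le hq
  -- For `0 < p < 1` all weights are positive; the endpoints `p = 0, 1` are recovered at the end by
  -- continuity in `p`.
  have main : ∀ p ∈ Set.Ioo (0 : ℝ) 1,
      fkEv G' ξ' p q (fun ω => g (pull φ ω)) ≤ fkEv G ξ p q g := by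
    intro p hp
    have hw : ∀ ω, 0 < weight (G := G') ξ' p q ω := by
      rw [weight_eq_edgeWeight]; exact edgeWeight_pos hp fun ω => pow_pos hq0 _
    have hsup : ∀ a b, weight (G := G') ξ' p q a * weight ξ' p q b ≤
        weight ξ' p q (a ⊓ b) * weight ξ' p q (a ⊔ b) := by
      rw [weight_eq_edgeWeight]
      exact edgeWeight_supermodular (Set.Ioo_subset_Icc_self hp)
        (pow_numClusters_supermodular hq ξ')
    -- `v` is the weight conditioned on all edges outside the image being open. It is the image
    -- under `push` of the weight on `G`, and it dominates the full weight because `D` is stable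
    -- under joins with any configuration.
    let D : Set (Config G') := {ω | ∀ e', (∀ e, φ.mapEdgeSet e ≠ e') → ω e' = true}
    let v : Config G' → ℝ := fun ω => if ω ∈ D then weight ξ' p q ω else 0
    have hv : ∀ ω, 0 ≤ v ω := fun ω => by
      simp only [v]; split_ifs; exacts [(hw ω).le, le_rfl]
    have hpush : ∀ ω : Config G, push φ ω ∈ D := fun ω e' h => push_of_notMem φ ω h
    have hinj : Function.Injective (push φ : Config G → Config G') := fun a b h => by
      rw [← pull_push φ a, h, pull_push]
    have hsum : ∀ f : Config G' → ℝ, ∑ ω, v ω * f ω =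
        p ^ (Finset.univ.map φ.mapEdgeSet)ᶜ.card *
          ∑ ω, weight ξ p q ω * f (push φ ω) := by
      intro f
      rw [Finset.mul_sum]
      refine (Fintype.sum_of_injective (push φ) hinj _ _ (fun ω' h' => ?_) fun ω => ?_).symm
      · have : ω' ∉ D := fun hD => h' ⟨pull φ ω', push_pull φ ω' hD⟩
        simp [v, this]
      · simp only [v, if_pos (hpush ω), weight_push p q hk]
        ring
    have hK : 0 < p ^ (Finset.univ.map φ.mapEdgeSet)ᶜ.card := pow_pos hp.1 _
    have hev : ev v (fun ω => g (pull φ ω)) = fkEv G ξ p q g := by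
      have h1 := hsum fun _ => 1
      simp only [mul_one] at h1
      rw [ev, hsum, h1, mul_div_mul_left _ _ hK.ne', fkEv, ev]
      simp only [pull_push]
    rw [← hev]
    refine ev_le_ev_of_holley (fun ω => (hw ω).le) hv
      (Finset.sum_pos (fun ω _ => hw ω) ⟨fun _ => true, Finset.mem_univ _⟩)
      (Finset.sum_pos' (fun ω _ => hv ω) ⟨fun _ => true, Finset.mem_univ _, ?_⟩)
      (hg.comp (pull_mono φ)) fun a b => ?_
    · have : (fun _ => true : Config G') ∈ D := fun _ _ => rfl
      simp only [v, if_pos this]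
      exact hw _
    · by_cases hb : b ∈ D
      · have : a ⊔ b ∈ D := fun e' he' => by rw [Pi.sup_apply, hb e' he']; simp
        simp only [v, if_pos hb, if_pos this]
        exact hsup a b
      · simp only [v, if_neg hb, mul_zero]
        exact mul_nonneg (hw _).le (hv _)
  have hcl : p ∈ closure (Set.Ioo (0 : ℝ) 1) := by rwa [closure_Ioo zero_ne_one]
  exact ContinuousWithinAt.closure_le hcl ((continuousOn_fkEv hq0 _ p hp).mono
    Set.Ioo_subset_Icc_self) ((continuousOn_fkEv hq0 _ p hp).mono Set.Ioo_subset_Icc_self) main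

end Comparison

end Pull

/-! ### Boxes of the lattice and their boundaries -/

section Boxes

variable {d : ℕ}

theorem mem_box {n : ℕ} {x : Fin d → ℤ} : x ∈ box d n ↔ ∀ i, |x i| ≤ n := by
  simp only [box, Set.mem_Icc, Pi.le_def, abs_le, forall_and]

theorem lattice_adj_abs_sub_le {x y : Fin d → ℤ} (h : (lattice d).Adj x y) (i : Fin d) :
    |x i - y i| ≤ 1 := by
  have h' : ∑ i, |x i - y i| = 1 := h
  rw [← h']
  exact Finset.single_le_sum (f := fun i => |x i - y i|) (fun i _ => abs_nonneg _)
    (Finset.mem_univ i)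

theorem lattice_adj_update (x : Fin d → ℤ) (i : Fin d) {σ : ℤ} (hσ : |σ| = 1) :
    (lattice d).Adj x (Function.update x i (x i + σ)) := by
  change ∑ j, |x j - Function.update x i (x i + σ) j| = 1
  rw [Finset.sum_eq_single i]
  · simpa using hσ
  · intro j _ hj; simp [hj]
  · simp

theorem lattice_adj_add {x y : Fin d → ℤ} (z : Fin d → ℤ) :
    (lattice d).Adj (z + x) (z + y) ↔ (lattice d).Adj x y := by
  simp [lattice]

theorem mem_boxBoundary {n : ℕ} {x : box d n} : x ∈ boxBoundary d n ↔ ∃ i, |x.1 i| = n := by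
  constructor
  · rintro ⟨y, hy, hxy⟩
    rw [mem_box] at hy
    push Not at hy
    obtain ⟨i, hi⟩ := hy
    refine ⟨i, le_antisymm (mem_box.1 x.2 i) ?_⟩
    have h1 := lattice_adj_abs_sub_le hxy i
    have h2 := abs_sub_abs_le_abs_sub (y i) (x.1 i)
    rw [abs_sub_comm] at h2
    omega
  · rintro ⟨i, hi⟩
    have key : ∀ σ : ℤ, |σ| = 1 → (n : ℤ) < |x.1 i + σ| → x ∈ boxBoundary d n :=
      fun σ hσ h => ⟨_, fun hm => absurd (mem_box.1 hm i) (by simpa using h),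
        lattice_adj_update x.1 i hσ⟩
    rcases le_total 0 (x.1 i) with h | h
    · refine key 1 (by simp) ?_
      rw [abs_of_nonneg h] at hi
      rw [abs_of_nonneg (by omega)]; omega
    · refine key (-1) (by simp) ?_
      rw [abs_of_nonpos h] at hi
      rw [abs_of_nonpos (by omega)]; omega

theorem boxBoundary_nonempty (hd : 1 ≤ d) (n : ℕ) : (boxBoundary d n).Nonempty :=
  ⟨⟨fun _ => n, mem_box.2 fun _ => by simp⟩, mem_boxBoundary.2 ⟨⟨0, hd⟩, by simp⟩⟩

/-- The translation by `x`, as an embedding of `Λ_m` into `Λ_N`. -/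
def boxEmb (x : Fin d → ℤ) (m N : ℕ) (h : ∀ i, |x i| + m ≤ N) : boxGraph d m ↪g boxGraph d N where
  toFun v := ⟨x + v.1, mem_box.2 fun i =>
    (abs_add_le _ _).trans ((add_le_add_right (mem_box.1 v.2 i) _).trans (h i))⟩
  inj' _ _ huv := Subtype.ext (add_left_cancel (congrArg Subtype.val huv))
  map_rel_iff' := lattice_adj_add x

theorem boxEmb_val (x : Fin d → ℤ) (m N : ℕ) (h : ∀ i, |x i| + m ≤ N) (v : box d m) :
    (boxEmb x m N h v).1 = x + v.1 := rfl

/-- The inclusion of `Λ_m` into `Λ_N`. -/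
def boxIncl {m N : ℕ} (h : m ≤ N) : boxGraph d m ↪g boxGraph d N :=
  boxEmb 0 m N fun i => by simpa using h

/-- The inclusion of `Λ_m` into `ℤ^d`. -/
def boxToLattice (d m : ℕ) : boxGraph d m ↪g lattice d := SimpleGraph.Embedding.induce _

theorem exists_boxEmb_eq {x : Fin d → ℤ} {m N : ℕ} (h : ∀ i, |x i| + m ≤ N) {y : box d N}
    (hy : ∀ i, |y.1 i - x i| ≤ m) : ∃ v, boxEmb x m N h v = y :=
  ⟨⟨y.1 - x, mem_box.2 hy⟩, Subtype.ext (add_sub_cancel x y.1)⟩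

/-! ### Opening everything outside a sub-box reproduces wiring -/

section Wiring

variable {x : Fin d → ℤ} {m N : ℕ} (h : ∀ i, |x i| + m ≤ N) (ω : Config (boxGraph d m))

/-- When the edges outside `x + Λ_m` are open, every vertex outside is connected to `∂Λ_N`. -/
theorem clusterSetoid_push_outside_aux {σ : ℤ} (hσ : |σ| = 1) (i : Fin d) (k : ℕ) :
    ∀ y : box d N, (N : ℤ) - σ * y.1 i = k → (m : ℤ) ≤ σ * (y.1 i - x i) →
      ∃ b ∈ boxBoundary d N,
        clusterSetoid (push (boxEmb x m N h) ω) (wired (boxBoundary d N)) y b := by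
  have hσ2 : σ * σ = 1 := by rw [← abs_mul_abs_self, hσ]; rfl
  induction k with
  | zero =>
    intro y hy _
    refine ⟨y, mem_boxBoundary.2 ⟨i, ?_⟩, Setoid.refl' _ _⟩
    have : |σ * y.1 i| = N := by
      rw [show σ * y.1 i = N by push_cast at hy; omega]; simp
    rwa [abs_mul, hσ, one_mul] at this
  | succ k ih =>
    intro y hy hm
    have hmem : Function.update y.1 i (y.1 i + σ) ∈ box d N := by
      refine mem_box.2 fun j => ?_
      by_cases hj : j = i
      · subst hj
        rw [Function.update_self]
        have h1 : |σ * (y.1 j + σ)| ≤ N := by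
          rw [abs_le]
          have h2 := mem_box.1 y.2 j
          rw [← one_mul |y.1 j|, ← hσ, ← abs_mul, abs_le] at h2
          push_cast at hy
          rw [mul_add, hσ2]
          constructor <;> omega
        rwa [abs_mul, hσ, one_mul] at h1
      · rw [Function.update_of_ne hj]
        exact mem_box.1 y.2 j
    -- Walk in direction `σ` along coordinate `i`, with `k` steps left to `∂Λ_N`. Since `y` is
    -- already at signed distance at least `m` from `x`, the next vertex is outside `x + Λ_m` and
    -- the edge to it is open.
    have hadj : (boxGraph d N).Adj y ⟨_, hmem⟩ := lattice_adj_update y.1 i hσ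
    obtain ⟨b, hb, hyb⟩ := ih ⟨_, hmem⟩
      (by dsimp only; rw [Function.update_self, mul_add, hσ2]; push_cast at hy; omega)
      (by
        dsimp only
        rw [Function.update_self, show y.1 i + σ - x i = (y.1 i - x i) + σ by ring, mul_add, hσ2]
        omega)
    refine ⟨b, hb, Setoid.trans' _ (clusterSetoid_of_adj
      (openGraph_push_adj_of_notMem hadj fun v hv => ?_)) hyb⟩
    have h3 := congrFun (congrArg Subtype.val hv) i
    rw [boxEmb_val] at h3
    simp only [Pi.add_apply, Function.update_self] at h3
    have h4 : σ * v.1 i ≤ m := by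
      have := mem_box.1 v.2 i
      rw [← one_mul |v.1 i|, ← hσ, ← abs_mul, abs_le] at this
      exact this.2
    rw [show v.1 i = (y.1 i - x i) + σ by omega, mul_add, hσ2] at h4
    omega

theorem clusterSetoid_push_outside {y : box d N} {i : Fin d} (hy : (m : ℤ) ≤ |y.1 i - x i|) :
    ∃ b ∈ boxBoundary d N,
      clusterSetoid (push (boxEmb x m N h) ω) (wired (boxBoundary d N)) y b := by
  have hyN := abs_le.1 (mem_box.1 y.2 i)
  rcases le_total 0 (y.1 i - x i) with h0 | h0
  · rw [abs_of_nonneg h0] at hy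
    exact clusterSetoid_push_outside_aux h ω (σ := 1) (by simp) i ((N : ℤ) - y.1 i).toNat y
      (by omega) (by omega)
  · rw [abs_of_nonpos h0] at hy
    exact clusterSetoid_push_outside_aux h ω (σ := -1) (by simp) i ((N : ℤ) + y.1 i).toNat y
      (by omega) (by omega)

/-- The open edges outside `x + Λ_m` join its boundary and all outer vertices to the wired `∂Λ_N`,
which has the effect of wiring `∂Λ_m`. Hence the map sending a vertex of `Λ_m` to its class in the
large box is surjective, with kernel the cluster relation of the small box. -/
theorem numClusters_push (hd : 1 ≤ d) :
    numClusters (push (boxEmb x m N h) ω) (wired (boxBoundary d N)) =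
      numClusters ω (wired (boxBoundary d m)) := by
  classical
  set φ := boxEmb x m N h with hφ
  set ρ' := clusterSetoid (push φ ω) (wired (boxBoundary d N)) with hρ'
  set ρ := clusterSetoid ω (wired (boxBoundary d m)) with hρ
  obtain ⟨v₀, hv₀⟩ := boxBoundary_nonempty hd m
  have hwired : ∀ {a b : box d N}, a ∈ boxBoundary d N → b ∈ boxBoundary d N → ρ' a b :=
    fun ha hb => clusterSetoid_of_boundary (Or.inr ⟨ha, hb⟩)
  have hbd : ∀ v ∈ boxBoundary d m, ∃ b ∈ boxBoundary d N, ρ' (φ v) b := by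
    intro v hv
    obtain ⟨i, hi⟩ := mem_boxBoundary.1 hv
    refine clusterSetoid_push_outside h ω (i := i) (le_of_eq ?_)
    rw [hφ, boxEmb_val, Pi.add_apply, add_sub_cancel_left, hi]
  let f : box d m → Quotient ρ' := fun v => Quotient.mk ρ' (φ v)
  have hf : Function.Surjective f := by
    intro c
    induction c using Quotient.inductionOn with | _ y
    by_cases hy : ∀ i, |y.1 i - x i| ≤ m
    · obtain ⟨v, rfl⟩ := exists_boxEmb_eq h hy
      exact ⟨v, rfl⟩
    · push Not at hy
      obtain ⟨i, hi⟩ := hy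
      obtain ⟨b, hb, hyb⟩ := clusterSetoid_push_outside h ω hi.le
      obtain ⟨b', hb', hvb⟩ := hbd v₀ hv₀
      exact ⟨v₀, Quotient.sound
        (Setoid.trans' _ hvb (Setoid.trans' _ (hwired hb' hb) (Setoid.symm' _ hyb)))⟩
  -- A retraction that sends the outside to the boundary class of `Λ_m`. It is constant on the
  -- classes of `ρ'`, so the large box creates no new identifications.
  let r : box d N → Quotient ρ := fun y =>
    if hy : ∃ v, φ v = y then Quotient.mk ρ hy.choose else Quotient.mk ρ v₀
  have hr : ∀ v, r (φ v) = Quotient.mk ρ v := by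
    intro v
    have hy : ∃ v', φ v' = φ v := ⟨v, rfl⟩
    simp only [r, dif_pos hy]
    rw [φ.injective hy.choose_spec]
  have hr0 : ∀ y, (∀ v, φ v = y → v ∈ boxBoundary d m) → r y = Quotient.mk ρ v₀ := by
    intro y hy
    by_cases hv : ∃ v, φ v = y
    · obtain ⟨v, rfl⟩ := hv
      rw [hr]
      exact Quotient.sound (clusterSetoid_of_boundary (Or.inr ⟨hy v rfl, hv₀⟩))
    · simp only [r, dif_neg hv]
  have hker : Setoid.ker f = ρ := by
    refine le_antisymm (fun u v huv => ?_) (clusterSetoid_le ?_ fun u v huv => ?_)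
    · have h1 : ρ' (φ u) (φ v) := Quotient.exact huv
      have h2 : ρ' ≤ Setoid.ker r := by
        refine clusterSetoid_le ?_ fun a b hab => ?_
        · rintro a b (rfl | ⟨ha, hb⟩)
          · rfl
          -- The inner box may touch `∂Λ_N`, but because `|x i| + m ≤ N` only at vertices of its own
          -- boundary.
          · have hN : ∀ a ∈ boxBoundary d N, r a = Quotient.mk ρ v₀ := by
              intro a ha
              refine hr0 a ?_
              rintro v rfl
              obtain ⟨i, hi⟩ := mem_boxBoundary.1 ha
              refine mem_boxBoundary.2 ⟨i, le_antisymm (mem_box.1 v.2 i) ?_⟩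
              rw [hφ, boxEmb_val, Pi.add_apply] at hi
              have := abs_add_le (x i) (v.1 i)
              have := h i
              omega
            exact (hN a ha).trans (hN b hb).symm
        · have hGab : (boxGraph d N).Adj a b := (openGraph_adj.1 hab).1
          have hin : ∀ {a b : box d N}, (boxGraph d N).Adj a b → (∀ v, φ v ≠ b) →
              ∀ v, φ v = a → v ∈ boxBoundary d m := by
            rintro a b hab hb v rfl
            refine ⟨b.1 - x, fun hm => hb ⟨b.1 - x, hm⟩ (Subtype.ext (add_sub_cancel x b.1)), ?_⟩
            rw [← lattice_adj_add x, add_sub_cancel]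
            exact hab
          by_cases hb : ∃ v, φ v = b
          · by_cases ha : ∃ v, φ v = a
            · obtain ⟨u, rfl⟩ := ha
              obtain ⟨v, rfl⟩ := hb
              change r _ = r _
              rw [hr, hr]
              exact Quotient.sound (clusterSetoid_of_adj (openGraph_push_adj.1 hab))
            · have ha' : ∀ v, φ v ≠ a := fun v hv => ha ⟨v, hv⟩
              exact (hr0 a fun v hv => absurd hv (ha' v)).trans
                (hr0 b (hin hGab.symm ha')).symm
          · have hb' : ∀ v, φ v ≠ b := fun v hv => hb ⟨v, hv⟩
            exact (hr0 a (hin hGab hb')).trans (hr0 b fun v hv => absurd hv (hb' v)).symm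
      have h3 : r (φ u) = r (φ v) := h2 h1
      rw [hr, hr] at h3
      exact Quotient.exact h3
    · rintro u v (rfl | ⟨hu, hv⟩)
      · rfl
      · obtain ⟨b, hb, hub⟩ := hbd u hu
        obtain ⟨b', hb', hvb⟩ := hbd v hv
        exact Quotient.sound
          (Setoid.trans' _ hub (Setoid.trans' _ (hwired hb hb') (Setoid.symm' _ hvb)))
    · exact Quotient.sound (clusterSetoid_of_adj (openGraph_push_adj.2 huv))
  rw [numClusters_eq_card, numClusters_eq_card, ← hρ, ← hρ', ← hker]
  exact (Nat.card_congr (Setoid.quotientKerEquivOfSurjective f hf)).symm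

end Wiring

/-- The expectation under `φ^1_{Λ_n,p,q}`. -/
@[irreducible] noncomputable def boxEv (d n : ℕ) (p q : ℝ) (g : Config (boxGraph d n) → ℝ) : ℝ :=
  fkEv (boxGraph d n) (wired (boxBoundary d n)) p q g

/-- The factor `q^{k(ω^1)}` of the weight of a configuration on `Λ_n`. -/
noncomputable def boxClusterWeight (d n : ℕ) (q : ℝ) (ω : Config (boxGraph d n)) : ℝ :=
  q ^ numClusters ω (wired (boxBoundary d n))

theorem boxClusterWeight_pos {n : ℕ} {q : ℝ} (hq : 0 < q) (ω : Config (boxGraph d n)) :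
    0 < boxClusterWeight d n q ω := pow_pos hq _

theorem boxClusterWeight_supermodular {n : ℕ} {q : ℝ} (hq : 1 ≤ q)
    (a b : Config (boxGraph d n)) : boxClusterWeight d n q a * boxClusterWeight d n q b ≤
      boxClusterWeight d n q (a ⊓ b) * boxClusterWeight d n q (a ⊔ b) :=
  pow_numClusters_supermodular hq _ a b

theorem boxEv_eq_ev {n : ℕ} [Fintype (boxGraph d n).edgeSet] [DecidableEq (boxGraph d n).edgeSet]
    (p q : ℝ) (g : Config (boxGraph d n) → ℝ) :
    boxEv d n p q g = ev (edgeWeight p (boxClusterWeight d n q)) g := by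
  unfold boxEv
  exact fkEv_eq_ev _ _ _ _

theorem boxMeasure_real {n : ℕ} {p q : ℝ} (hp : p ∈ Set.Icc (0 : ℝ) 1) (hq : 0 < q)
    (A : Set (Config (boxGraph d n))) : (boxMeasure d n p q).real A = boxEv d n p q (ind A) := by
  unfold boxEv
  exact finiteMeasure_real _ hp hq A

theorem boxEv_mono {n : ℕ} {p q : ℝ} (hp : p ∈ Set.Icc (0 : ℝ) 1) (hq : 0 < q)
    {f g : Config (boxGraph d n) → ℝ} (h : ∀ ω, f ω ≤ g ω) :
    boxEv d n p q f ≤ boxEv d n p q g := by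
  unfold boxEv
  exact fkEv_mono hp hq h

theorem boxEv_sub {n : ℕ} {p q : ℝ} (f g : Config (boxGraph d n) → ℝ) :
    boxEv d n p q (fun ω => f ω - g ω) = boxEv d n p q f - boxEv d n p q g := by
  classical
  rw [boxEv_eq_ev, boxEv_eq_ev, boxEv_eq_ev, ev_sub]

theorem boxEv_const {p q : ℝ} (hp : p ∈ Set.Icc (0 : ℝ) 1) (hq : 0 < q) (n : ℕ) (c : ℝ) :
    boxEv d n p q (fun _ => c) = c := by
  classical
  rw [boxEv_eq_ev]
  exact ev_const (sum_edgeWeight_pos hp (boxClusterWeight_pos hq)) c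

/-- Comparison of the wired measures on two boxes. -/
theorem boxEv_pull_le (hd : 1 ≤ d) {x : Fin d → ℤ} {m N : ℕ} (h : ∀ i, |x i| + m ≤ N) {p q : ℝ}
    (hq : 1 ≤ q) (hp : p ∈ Set.Icc (0 : ℝ) 1) {g : Config (boxGraph d m) → ℝ} (hg : Monotone g) :
    boxEv d N p q (fun ω => g (pull (boxEmb x m N h) ω)) ≤ boxEv d m p q g := by
  unfold boxEv
  exact fkEv_pull_le hq (fun ω => numClusters_push h ω hd) hp hg

end Boxes

/-! ### Connection probabilities and the differential inequality -/

section Crossing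

theorem ind_mono {α : Type*} [Preorder α] {A : Set α} (h : IsUpperSet A) : Monotone (ind A) := by
  intro a b hab
  by_cases ha : a ∈ A
  · simp [ind, ha, h hab ha]
  · simp only [ind, Set.indicator_of_notMem ha]
    exact Set.indicator_nonneg (fun _ _ => zero_le_one) b

theorem ind_mem_Icc {α : Type*} (A : Set α) (a : α) : ind A a ∈ Set.Icc (0 : ℝ) 1 := by
  by_cases ha : a ∈ A <;> simp [ind, ha]

theorem ind_of_mem {α : Type*} {A : Set α} {a : α} (h : a ∈ A) : ind A a = 1 :=
  Set.indicator_of_mem h _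

theorem ind_of_notMem {α : Type*} {A : Set α} {a : α} (h : a ∉ A) : ind A a = 0 :=
  Set.indicator_of_notMem h _

theorem ind_le_ind {α : Type*} {A B : Set α} (h : A ⊆ B) (a : α) : ind A a ≤ ind B a :=
  Set.indicator_le_indicator_of_subset h (fun _ => zero_le_one) a

theorem ind_le_one {α : Type*} (A : Set α) (a : α) : ind A a ≤ 1 := (ind_mem_Icc A a).2

theorem ind_nonneg {α : Type*} (A : Set α) (a : α) : 0 ≤ ind A a := (ind_mem_Icc A a).1

variable {d : ℕ}

theorem boxEv_ind_mem_Icc {n : ℕ} {p q : ℝ} (hp : p ∈ Set.Icc (0 : ℝ) 1) (hq : 0 < q)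
    (A : Set (Config (boxGraph d n))) : boxEv d n p q (ind A) ∈ Set.Icc (0 : ℝ) 1 := by
  have h0 := boxEv_mono hp hq (ind_nonneg A)
  have h1 := boxEv_mono hp hq (ind_le_one A)
  rw [boxEv_const hp hq] at h0 h1
  exact ⟨h0, h1⟩

/-- The event `0 ↔ ∂Λ_n` in `Λ_n`. -/
def crossing (d n : ℕ) : Set (Config (boxGraph d n)) :=
  connected (boxGraph d n) {origin d n} (boxBoundary d n)

theorem mem_crossing {n : ℕ} {ω : Config (boxGraph d n)} :
    ω ∈ crossing d n ↔ ∃ b ∈ boxBoundary d n, (openGraph ω).Reachable (origin d n) b := by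
  simp [crossing, connected]

theorem isUpperSet_crossing (n : ℕ) : IsUpperSet (crossing d n) := by
  intro a b hab ha
  rw [mem_crossing] at ha ⊢
  obtain ⟨y, hy, hr⟩ := ha
  exact ⟨y, hy, hr.mono (openGraph_mono hab)⟩

/-- A path from the box `x + Λ_m` to a vertex that is not in its interior visits its boundary. -/
theorem exists_reachable_boundary {V' : Type*} {G' : SimpleGraph V'} {c : V' → (Fin d → ℤ)}
    (hc : Function.Injective c) (hadj : ∀ u v, G'.Adj u v → (lattice d).Adj (c u) (c v))
    {m : ℕ} (φ : boxGraph d m ↪g G') {x : Fin d → ℤ} (hφ : ∀ v, c (φ v) = x + v.1)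
    {ω : Config G'} {u : box d m} {y : V'} (hr : (openGraph ω).Reachable (φ u) y) {i : Fin d}
    (hi : (m : ℤ) ≤ |c y i - x i|) :
    ∃ b ∈ boxBoundary d m, (openGraph (pull φ ω)).Reachable u b := by
  have hb : ∀ v, φ v = y → v ∈ boxBoundary d m := by
    rintro v rfl
    rw [hφ, Pi.add_apply, add_sub_cancel_left] at hi
    exact mem_boxBoundary.2 ⟨i, le_antisymm (mem_box.1 v.2 i) hi⟩
  rcases reachable_pull_or_exit hr with ⟨v, hv, huv⟩ | ⟨v, huv, z, hz, hvz⟩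
  · exact ⟨v, hb v hv, huv⟩
  · refine ⟨v, ⟨c z - x, fun hm => hz ⟨c z - x, hm⟩ (hc ?_), ?_⟩, huv⟩
    · rw [hφ]; exact add_sub_cancel x (c z)
    · rw [← lattice_adj_add x, add_sub_cancel, ← hφ]
      exact hadj _ _ (openGraph_adj.1 hvz).1

theorem pull_mem_crossing_of_reachable {m N : ℕ} {x : Fin d → ℤ} (h : ∀ i, |x i| + m ≤ N)
    {ω : Config (boxGraph d N)} {y : box d N}
    (hr : (openGraph ω).Reachable (boxEmb x m N h (origin d m)) y) {i : Fin d}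
    (hi : (m : ℤ) ≤ |y.1 i - x i|) : pull (boxEmb x m N h) ω ∈ crossing d m := by
  obtain ⟨b, hb, hr'⟩ := exists_reachable_boundary (c := Subtype.val) Subtype.val_injective
    (fun _ _ h => h) (boxEmb x m N h) (fun v => boxEmb_val x m N h v) hr hi
  exact mem_crossing.2 ⟨b, hb, hr'⟩

theorem boxIncl_origin {m N : ℕ} (h : m ≤ N) : boxIncl h (origin d m) = origin d N :=
  Subtype.ext (by simp [boxIncl, boxEmb_val, origin])

theorem pull_boxIncl_mem_crossing {m N : ℕ} (h : m ≤ N) {ω : Config (boxGraph d N)}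
    (hω : ω ∈ crossing d N) : pull (boxIncl h) ω ∈ crossing d m := by
  obtain ⟨b, hb, hr⟩ := mem_crossing.1 hω
  obtain ⟨i, hi⟩ := mem_boxBoundary.1 hb
  rw [← boxIncl_origin h] at hr
  refine pull_mem_crossing_of_reachable _ hr (i := i) ?_
  simp only [Pi.zero_apply, sub_zero, hi]
  exact_mod_cast h

theorem pull_boxIncl_boxIncl {l m N : ℕ} (h1 : l ≤ m) (h2 : m ≤ N) (ω : Config (boxGraph d N)) :
    pull (boxIncl h1) (pull (boxIncl h2) ω) = pull (boxIncl (h1.trans h2)) ω :=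
  pull_pull _ _ _ (fun v => Subtype.ext (by simp [boxIncl, boxEmb_val])) ω

theorem le_two_mul_self (n : ℕ) : n ≤ 2 * n := by omega

/-- The probability `φ^1_{Λ_{2n},p,q}[0 ↔ ∂Λ_n]`. -/
@[irreducible] noncomputable def theta (d : ℕ) (q : ℝ) (n : ℕ) (p : ℝ) : ℝ :=
  boxEv d (2 * n) p q (ind {ω | pull (boxIncl (le_two_mul_self n)) ω ∈ crossing d n})

theorem theta_eq (d : ℕ) (q : ℝ) (n : ℕ) (p : ℝ) : theta d q n p =
    boxEv d (2 * n) p q (ind {ω | pull (boxIncl (le_two_mul_self n)) ω ∈ crossing d n}) := by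
  rw [theta]

/-- The sup norm of an integer vector. -/
def supAbs (x : Fin d → ℤ) : ℕ := Finset.univ.sup fun i => (x i).natAbs

theorem natAbs_le_supAbs (x : Fin d → ℤ) (i : Fin d) : (x i).natAbs ≤ supAbs x :=
  Finset.le_sup (f := fun i => (x i).natAbs) (Finset.mem_univ i)

theorem exists_natAbs_eq_supAbs (hd : 1 ≤ d) (x : Fin d → ℤ) : ∃ i, (x i).natAbs = supAbs x := by
  obtain ⟨i, -, hi⟩ := Finset.exists_mem_eq_sup Finset.univ ⟨(⟨0, hd⟩ : Fin d), Finset.mem_univ _⟩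
    fun i => (x i).natAbs
  exact ⟨i, hi.symm⟩

theorem mem_box_iff_supAbs {n : ℕ} {x : Fin d → ℤ} : x ∈ box d n ↔ supAbs x ≤ n := by
  rw [mem_box, supAbs, Finset.sup_le_iff]
  refine ⟨fun h i _ => ?_, fun h i => ?_⟩
  · have := h i
    rw [Int.abs_eq_natAbs] at this
    omega
  · have := h i (Finset.mem_univ i)
    rw [Int.abs_eq_natAbs]
    omega

theorem exists_dist_supAbs_le (hd : 1 ≤ d) (x y : Fin d → ℤ) :
    ∃ i, (Nat.dist (supAbs y) (supAbs x) : ℤ) ≤ |y i - x i| := by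
  obtain ⟨i, hi⟩ := exists_natAbs_eq_supAbs hd x
  obtain ⟨j, hj⟩ := exists_natAbs_eq_supAbs hd y
  rcases le_total (supAbs x) (supAbs y) with h | h
  · have := natAbs_le_supAbs x j
    exact ⟨j, by rw [Nat.dist_eq_sub_of_le_right h, Int.abs_eq_natAbs]; omega⟩
  · have := natAbs_le_supAbs y i
    exact ⟨i, by rw [Nat.dist_eq_sub_of_le h, Int.abs_eq_natAbs]; omega⟩

variable {q p : ℝ} {n : ℕ}

/-- The configurations of `Λ_{2n}` for which `v` is connected to `∂Λ_k` in `Λ_n`. -/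
def touches (n k : ℕ) (v : box d n) : Set (Config (boxGraph d (2 * n))) :=
  {ω | ∃ b : box d n, supAbs b.1 = k ∧
    (openGraph (pull (boxIncl (le_two_mul_self n)) ω)).Reachable b v}

/-- If `v` is connected to `∂Λ_k`, then the box of radius `j / 2` around `v` is crossed from its
centre. As `v` is in `Λ_n` and `j ≤ n`, the box of radius `2 (j / 2)` around `v` fits in `Λ_{2n}`,
and comparison with it gives exactly `theta` at `j / 2`. -/
theorem boxEv_touches_le (hd : 1 ≤ d) (hq : 1 ≤ q) (hp : p ∈ Set.Icc (0 : ℝ) 1) {k : ℕ}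
    (hk : k ≤ n) (v : box d n) :
    boxEv d (2 * n) p q (ind (touches n k v)) ≤
      theta d q (Nat.dist k (supAbs v.1) / 2) p := by
  set j := Nat.dist k (supAbs v.1) with hj
  have hv : supAbs v.1 ≤ n := mem_box_iff_supAbs.1 v.2
  have hjn : j ≤ n := by rw [hj, Nat.dist]; omega
  have h1 : ∀ i, |v.1 i| + ((2 * (j / 2) : ℕ) : ℤ) ≤ (2 * n : ℕ) := fun i => by
    have := mem_box.1 v.2 i
    omega
  have h2 : ∀ i, |v.1 i| + ((j / 2 : ℕ) : ℤ) ≤ (2 * n : ℕ) := fun i => by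
    have := mem_box.1 v.2 i
    omega
  rw [theta_eq]
  refine le_trans ?_ (boxEv_pull_le hd h1 hq hp
    (ind_mono ((isUpperSet_crossing (d := d) (j / 2)).preimage (pull_mono _))))
  refine boxEv_mono hp (zero_lt_one.trans_le hq) fun ω => ind_le_ind
    (B := {ω | pull (boxIncl (le_two_mul_self (j / 2)))
      (pull (boxEmb v.1 (2 * (j / 2)) (2 * n) h1) ω) ∈ crossing d (j / 2)}) ?_ ω
  rintro ω ⟨b, hb, hr⟩
  have e : pull (boxIncl (le_two_mul_self (j / 2)))
      (pull (boxEmb v.1 (2 * (j / 2)) (2 * n) h1) ω) = pull (boxEmb v.1 (j / 2) (2 * n) h2) ω :=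
    pull_pull _ _ _ (fun v => Subtype.ext (by simp [boxIncl, boxEmb_val])) ω
  rw [Set.mem_ofPred_eq, e]
  obtain ⟨i, hi⟩ := exists_dist_supAbs_le hd v.1 b.1
  have hr' := (reachable_of_pull hr).symm
  have ev : boxIncl (le_two_mul_self n) v = boxEmb v.1 (j / 2) (2 * n) h2 (origin d (j / 2)) :=
    Subtype.ext (by simp [boxIncl, boxEmb_val, origin])
  rw [ev] at hr'
  refine pull_mem_crossing_of_reachable h2 hr' (i := i) ?_
  rw [hb, ← hj] at hi
  have eb : (boxIncl (le_two_mul_self n) b).1 = b.1 := by simp [boxIncl, boxEmb_val]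
  rw [eb]
  omega

theorem theta_mem_Icc (hq : 1 ≤ q) (hp : p ∈ Set.Icc (0 : ℝ) 1) (n : ℕ) :
    theta d q n p ∈ Set.Icc (0 : ℝ) 1 := by
  rw [theta_eq]
  exact boxEv_ind_mem_Icc hp (zero_lt_one.trans_le hq) _

/-- Each value `i` is taken at most four times, at `k = s ± 2i` and `k = s ± (2i + 1)`. -/
theorem sum_half_dist_le (F : ℕ → ℝ) (hF : ∀ i, 0 ≤ F i) {s n : ℕ} (hs : s ≤ n) :
    ∑ k ∈ Finset.range n, F (Nat.dist k s / 2) ≤ 4 * ∑ i ∈ Finset.range n, F i := by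
  have hmap : ∀ k ∈ Finset.range n, Nat.dist k s / 2 ∈ Finset.range n := fun k hk => by
    rw [Finset.mem_range] at hk ⊢
    rw [Nat.dist]; omega
  rw [← Finset.sum_fiberwise_of_maps_to hmap, Finset.mul_sum]
  refine Finset.sum_le_sum fun i _ => ?_
  rw [Finset.sum_congr rfl fun k hk => by rw [(Finset.mem_filter.1 hk).2], Finset.sum_const,
    nsmul_eq_mul]
  refine mul_le_mul_of_nonneg_right ?_ (hF i)
  have hsub : (Finset.range n).filter (fun k => Nat.dist k s / 2 = i) ⊆
      {s + 2 * i, s + 2 * i + 1, s - 2 * i, s - 2 * i - 1} := fun k hk => by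
    have := (Finset.mem_filter.1 hk).2
    rw [Nat.dist] at this
    simp only [Finset.mem_insert, Finset.mem_singleton]
    omega
  exact_mod_cast (Finset.card_le_card hsub).trans Finset.card_le_four

/-- A connection to `∂Λ_k` can be explored by revealing only edges that touch the clusters
of `∂Λ_k`. -/
theorem crossing_explored {k : ℕ} (hk : k < n)
    (S : Finset (boxGraph d (2 * n)).edgeSet) (x : Config (boxGraph d (2 * n))) :
    (∀ ω : Config (boxGraph d (2 * n)), (∀ e ∈ S, ω e = x e) →
      (pull (boxIncl (le_two_mul_self n)) ω ∈ crossing d n ↔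
        pull (boxIncl (le_two_mul_self n)) x ∈ crossing d n)) ∨
    ∃ e ∉ S, ∀ ω : Config (boxGraph d (2 * n)), (∀ e ∈ S, ω e = x e) →
      ∃ u v : box d n, ∃ h : (boxGraph d n).Adj u v,
        (boxIncl (le_two_mul_self n)).mapEdgeSet ⟨s(u, v), h⟩ = e ∧ ω ∈ touches n k u := by
  classical
  by_cases hex : ∃ e ∉ S, ∀ ω : Config (boxGraph d (2 * n)), (∀ e ∈ S, ω e = x e) →
      ∃ u v : box d n, ∃ h : (boxGraph d n).Adj u v,
        (boxIncl (le_two_mul_self n)).mapEdgeSet ⟨s(u, v), h⟩ = e ∧ ω ∈ touches n k u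
  · exact Or.inr hex
  refine Or.inl fun ω hω => ?_
  set ι := boxIncl (d := d) (le_two_mul_self n) with hι
  -- The smallest configuration compatible with the revealed values.
  let z : Config (boxGraph d (2 * n)) := fun e => if e ∈ S then x e else false
  have hz : ∀ ω' : Config (boxGraph d (2 * n)), (∀ e ∈ S, ω' e = x e) → z ≤ ω' := by
    intro ω' h' e
    by_cases he : e ∈ S
    · simp only [z, if_pos he, h' e he]; exact le_rfl
    · simp only [z, if_neg he]; exact Bool.false_le _
  -- If no unrevealed edge is known to touch the clusters of `∂Λ_k`, these clusters are the same for
  -- every compatible configuration: the first edge leaving the cluster in `z` would be such an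
  -- unrevealed edge.
  have step : ∀ ω' : Config (boxGraph d (2 * n)), (∀ e ∈ S, ω' e = x e) →
      ∀ b : box d n, supAbs b.1 = k → ∀ u, (openGraph (pull ι ω')).Reachable b u →
        (openGraph (pull ι z)).Reachable b u := by
    intro ω' h' b hb u hr
    rw [SimpleGraph.reachable_iff_reflTransGen] at hr
    induction hr with
    | refl => exact .refl _
    | @tail u v _ huv ih =>
      refine ih.trans (SimpleGraph.Adj.reachable ?_)
      obtain ⟨hG, ho⟩ := openGraph_adj.1 huv
      refine openGraph_adj.2 ⟨hG, ?_⟩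
      by_cases he : ι.mapEdgeSet ⟨s(u, v), hG⟩ ∈ S
      · change z _ = true
        simp only [z, if_pos he]
        rw [← h' _ he]; exact ho
      · exact absurd ⟨_, he, fun ω'' h'' => ⟨u, v, hG, rfl, b, hb,
          ih.mono (openGraph_mono (pull_mono ι (hz ω'' h'')))⟩⟩ hex
  -- A path from `0` to `∂Λ_n` visits `∂Λ_k` because `k < n`, so both ends belong to the cluster of
  -- a vertex of `∂Λ_k`, which is already known.
  have key : ∀ ω' : Config (boxGraph d (2 * n)), (∀ e ∈ S, ω' e = x e) →
      (pull ι ω' ∈ crossing d n ↔ pull ι z ∈ crossing d n) := by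
    intro ω' h'
    refine ⟨fun hc => ?_, fun hc => isUpperSet_crossing n (pull_mono ι (hz ω' h')) hc⟩
    obtain ⟨b₀, hb₀, hr₀⟩ := mem_crossing.1 (pull_boxIncl_mem_crossing hk.le hc)
    obtain ⟨B, hB, hrB⟩ := mem_crossing.1 hc
    have hr := reachable_of_pull hr₀
    rw [boxIncl_origin] at hr
    set b := boxIncl hk.le b₀ with hbdef
    have hb : supAbs b.1 = k := by
      have e : b.1 = b₀.1 := by simp [hbdef, boxIncl, boxEmb_val]
      rw [e]
      obtain ⟨i, hi⟩ := mem_boxBoundary.1 hb₀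
      rw [Int.abs_eq_natAbs] at hi
      have := natAbs_le_supAbs b₀.1 i
      have := mem_box_iff_supAbs.1 b₀.2
      omega
    exact mem_crossing.2 ⟨B, hB, (step ω' h' b hb _ hr.symm).symm.trans
      (step ω' h' b hb _ (hr.symm.trans hrB))⟩
  exact (key ω hω).trans (key x fun _ _ => rfl).symm

/-- The differential inequality for `theta`. -/
theorem hasDerivAt_theta (hd : 1 ≤ d) (hq : 1 ≤ q) (hp : p ∈ Set.Ioo (0 : ℝ) 1) (n : ℕ) :
    ∃ θ' : ℝ, HasDerivAt (theta d q n) θ' p ∧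
      n * (theta d q n p * (1 - theta d q n p)) ≤
        8 * (∑ i ∈ Finset.range n, theta d q i p) * θ' := by
  classical
  have hq0 := zero_lt_one.trans_le hq
  have hp' := Set.Ioo_subset_Icc_self hp
  set ι := boxIncl (d := d) (le_two_mul_self n) with hι
  set A : Set (Config (boxGraph d (2 * n))) := {ω | pull ι ω ∈ crossing d n} with hA
  set κ := boxClusterWeight d (2 * n) q with hκ
  have hκ0 : ∀ ω, 0 < κ ω := boxClusterWeight_pos hq0
  have hev : ∀ t g, boxEv d (2 * n) t q g = ev (edgeWeight t κ) g := fun t g => boxEv_eq_ev t q g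
  have hθ : theta d q n = fun t => ev (edgeWeight t κ) (ind A) :=
    funext fun t => (theta_eq _ _ _ _).trans (hev t _)
  set w := edgeWeight p κ with hw
  have hw0 : ∀ ω, 0 < w ω := edgeWeight_pos hp hκ0
  have hws : ∀ a b, w a * w b ≤ w (a ⊓ b) * w (a ⊔ b) :=
    edgeWeight_supermodular hp' (boxClusterWeight_supermodular hq)
  have hAu : Monotone (ind A) := ind_mono ((isUpperSet_crossing n).preimage (pull_mono ι))
  have hcov : ∀ e, 0 ≤ cov w (ind A) (isOpenInd e) := fun e =>
    cov_nonneg (fun ω => (hw0 ω).le) (sum_edgeWeight_pos hp' hκ0) hws hAu (isOpenInd_mono e)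
  refine ⟨_, by rw [hθ]; exact hasDerivAt_ev_edgeWeight hp hκ0 (ind A), ?_⟩
  -- Upper bound on the revealment for the exploration from `∂Λ_k`: the edge lies in `Λ_n` and one
  -- of its endpoints is connected to `∂Λ_k`.
  let R : ℕ → (boxGraph d (2 * n)).edgeSet → Config (boxGraph d (2 * n)) → ℝ := fun k e =>
    ind {ω | ∃ u v : box d n, ∃ h : (boxGraph d n).Adj u v,
      ι.mapEdgeSet ⟨s(u, v), h⟩ = e ∧ ω ∈ touches n k u}
  have hosss : ∀ k < n, cov w (ind A) (ind A) ≤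
      ∑ e, ev w (R k e) * cov w (ind A) (isOpenInd e) := by
    intro k hk
    refine osss hw0 hws hAu (ind_mem_Icc A) (fun e ω => ind_nonneg _ _) fun S x => ?_
    refine (crossing_explored hk S x).imp (fun h ω hω => ?_) fun ⟨e, he, h⟩ =>
      ⟨e, he, fun ω hω => ind_of_mem (h ω hω)⟩
    by_cases hx : x ∈ A
    · rw [ind_of_mem hx, ind_of_mem (A := A) ((h ω hω).2 hx)]
    · rw [ind_of_notMem hx, ind_of_notMem (A := A) fun h' => hx ((h ω hω).1 h')]
  set Sn := ∑ i ∈ Finset.range n, theta d q i p with hSn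
  have hvert : ∀ v : box d n, ∑ k ∈ Finset.range n, ev w (ind (touches n k v)) ≤ 4 * Sn := by
    intro v
    refine (Finset.sum_le_sum fun k hk => ?_).trans (sum_half_dist_le (fun i => theta d q i p)
      (fun i => (theta_mem_Icc hq hp' i).1) (mem_box_iff_supAbs.1 v.2))
    rw [← hev]
    exact boxEv_touches_le hd hq hp' (Finset.mem_range.1 hk).le v
  have hSn0 : 0 ≤ Sn := Finset.sum_nonneg fun i _ => (theta_mem_Icc hq hp' i).1
  -- The constant `8` is `4` for each of the two endpoints; edges outside `Λ_n` are never revealed.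
  have hedge : ∀ e, ∑ k ∈ Finset.range n, ev w (R k e) ≤ 8 * Sn := by
    intro e
    by_cases he : ∃ e₀, ι.mapEdgeSet e₀ = e
    · obtain ⟨⟨e₀, hG⟩, rfl⟩ := he
      induction e₀ using Sym2.ind with | _ a b
      have h1 : ∀ k, ev w (R k (ι.mapEdgeSet ⟨s(a, b), hG⟩)) ≤
          ev w (ind (touches n k a)) + ev w (ind (touches n k b)) := by
        intro k
        rw [← ev_add]
        refine ev_mono (fun ω => (hw0 ω).le) fun ω _ => ?_
        by_cases hω : ω ∈ {ω | ∃ u v : box d n, ∃ h : (boxGraph d n).Adj u v,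
            ι.mapEdgeSet ⟨s(u, v), h⟩ = ι.mapEdgeSet ⟨s(a, b), hG⟩ ∧ ω ∈ touches n k u}
        · have e1 : R k (ι.mapEdgeSet ⟨s(a, b), hG⟩) ω = 1 := ind_of_mem hω
          rw [e1]
          obtain ⟨u, v, h, heq, hu⟩ := hω
          have e2 : ind (touches n k u) ω = 1 := ind_of_mem hu
          have huv : s(u, v) = s(a, b) := congrArg Subtype.val (ι.mapEdgeSet.injective heq)
          rcases Sym2.eq_iff.1 huv with ⟨rfl, -⟩ | ⟨rfl, -⟩
          · rw [e2]; linarith [ind_nonneg (touches n k b) ω]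
          · rw [e2]; linarith [ind_nonneg (touches n k a) ω]
        · have e1 : R k (ι.mapEdgeSet ⟨s(a, b), hG⟩) ω = 0 := ind_of_notMem hω
          rw [e1]
          exact add_nonneg (ind_nonneg _ _) (ind_nonneg _ _)
      refine (Finset.sum_le_sum fun k _ => h1 k).trans ?_
      rw [Finset.sum_add_distrib]
      linarith [hvert a, hvert b]
    · have h0 : ∀ k, ev w (R k e) = 0 := by
        intro k
        rw [← ev_const (sum_edgeWeight_pos hp' hκ0) 0]
        refine ev_congr fun ω _ => ind_of_notMem ?_
        rintro ⟨u, v, h, heq, -⟩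
        exact he ⟨_, heq⟩
      simp only [h0, Finset.sum_const_zero]
      positivity
  have hvar : cov w (ind A) (ind A) = theta d q n p * (1 - theta d q n p) := by
    have h1 : ∀ ω, ind A ω * ind A ω = ind A ω := fun ω => by
      by_cases h : ω ∈ A <;> simp [ind, h]
    simp only [cov, h1, hθ]
    ring
  rw [← hvar]
  -- The OSSS inequality is summed over the `n` explorations `k < n`, so that only the averaged
  -- revealment matters. The last step uses `p (1 - p) ≤ 1` in Russo's formula.
  calc (n : ℝ) * cov w (ind A) (ind A)
      = ∑ k ∈ Finset.range n, cov w (ind A) (ind A) := by simp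
    _ ≤ ∑ k ∈ Finset.range n, ∑ e, ev w (R k e) * cov w (ind A) (isOpenInd e) :=
        Finset.sum_le_sum fun k hk => hosss k (Finset.mem_range.1 hk)
    _ = ∑ e, (∑ k ∈ Finset.range n, ev w (R k e)) * cov w (ind A) (isOpenInd e) := by
        rw [Finset.sum_comm]
        exact Finset.sum_congr rfl fun e _ => (Finset.sum_mul _ _ _).symm
    _ ≤ ∑ e, 8 * Sn * cov w (ind A) (isOpenInd e) :=
        Finset.sum_le_sum fun e _ => mul_le_mul_of_nonneg_right (hedge e) (hcov e)
    _ = 8 * Sn * ∑ e, cov w (ind A) (isOpenInd e) := (Finset.mul_sum _ _ _).symm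
    _ ≤ 8 * Sn * ((∑ e, cov w (ind A) (isOpenInd e)) / (p * (1 - p))) := by
        refine mul_le_mul_of_nonneg_left ?_ (by positivity)
        have h1 : 0 < p * (1 - p) := mul_pos hp.1 (sub_pos.2 hp.2)
        rw [le_div_iff₀ h1]
        have h2 : 0 ≤ ∑ e, cov w (ind A) (isOpenInd e) := Finset.sum_nonneg fun e _ => hcov e
        refine mul_le_of_le_one_right h2 ?_
        nlinarith [hp.1, hp.2]

end Crossing

/-! ### The infinite-volume measure and the convergence of `theta` -/

section InfiniteVolume

/-- Every function on a finite product of copies of `{0,1}` is a difference of two increasing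
functions. -/
theorem exists_monotone_sub {E : Type*} [Finite E] (g : (E → Bool) → ℝ) :
    ∃ g₁ g₂ : (E → Bool) → ℝ, Monotone g₁ ∧ Monotone g₂ ∧ ∀ ω, g ω = g₁ ω - g₂ ω := by
  classical
  have := Fintype.ofFinite E
  obtain ⟨C, hC⟩ : ∃ C, ∀ ω, |g ω| ≤ C := by
    obtain ⟨C, hC⟩ := (Set.finite_range fun ω => |g ω|).bddAbove
    exact ⟨C, fun ω => hC ⟨ω, rfl⟩⟩
  have hC0 : 0 ≤ C := (abs_nonneg _).trans (hC fun _ => true)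
  -- Each additional open edge adds `2C`, at least the oscillation of `g`, so adding this function
  -- to `g` makes it increasing.
  have hmono : Monotone fun ω : E → Bool => 2 * C * ∑ e, isOpenInd e ω := fun a b hab =>
    mul_le_mul_of_nonneg_left (Finset.sum_le_sum fun e _ => isOpenInd_mono e hab) (by positivity)
  refine ⟨fun ω => g ω + 2 * C * ∑ e, isOpenInd e ω, _, fun a b hab => ?_, hmono,
    fun ω => by ring⟩
  by_cases h : a = b
  · rw [h]
  · obtain ⟨e, he⟩ := Function.ne_iff.1 h
    have h1 : (∑ e, isOpenInd e a) + 1 ≤ ∑ e, isOpenInd e b := by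
      have h2 : isOpenInd e a + 1 ≤ isOpenInd e b := by
        have hlt : a e < b e := lt_of_le_of_ne (hab e) he
        obtain ⟨ha, hb⟩ := Bool.lt_iff.1 hlt
        simp [isOpenInd, ha, hb]
      rw [← Finset.add_sum_erase _ _ (Finset.mem_univ e),
        ← Finset.add_sum_erase (a := e) _ (fun e => isOpenInd e b) (Finset.mem_univ e)]
      have := Finset.sum_le_sum fun i (_ : i ∈ Finset.univ.erase e) => isOpenInd_mono i hab
      linarith
    have := mul_le_mul_of_nonneg_left h1 (by positivity : 0 ≤ 2 * C)
    have h3 := abs_le.1 (hC a)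
    have h4 := abs_le.1 (hC b)
    dsimp only
    linarith

variable {d : ℕ} {p q : ℝ}

theorem boxEv_pull_boxIncl_anti (hd : 1 ≤ d) (hq : 1 ≤ q) (hp : p ∈ Set.Icc (0 : ℝ) 1) {k n N : ℕ}
    (h1 : k ≤ n) (h2 : n ≤ N) {g : Config (boxGraph d k) → ℝ} (hg : Monotone g) :
    boxEv d N p q (fun ω => g (pull (boxIncl (h1.trans h2)) ω)) ≤
      boxEv d n p q (fun ω => g (pull (boxIncl h1) ω)) := by
  have := boxEv_pull_le hd (x := 0) (m := n) (N := N) (fun i => by simpa using h2) hq hp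
    (hg.comp (pull_mono (boxIncl h1)))
  simp only [← pull_boxIncl_boxIncl h1 h2]
  exact this

theorem boxEv_ind_pull_anti (hd : 1 ≤ d) (hq : 1 ≤ q) (hp : p ∈ Set.Icc (0 : ℝ) 1) {k n N : ℕ}
    (h1 : k ≤ n) (h2 : n ≤ N) :
    boxEv d N p q (ind {ω | pull (boxIncl (h1.trans h2)) ω ∈ crossing d k}) ≤
      boxEv d n p q (ind {ω | pull (boxIncl h1) ω ∈ crossing d k}) :=
  boxEv_pull_boxIncl_anti hd hq hp h1 h2 (ind_mono (isUpperSet_crossing k))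

/-- For increasing `g` the sequence decreases in `n` and is bounded below; the general case follows
by writing `g` as a difference of increasing functions. -/
theorem exists_tendsto_boxEv (hd : 1 ≤ d) (hq : 1 ≤ q) (hp : p ∈ Set.Icc (0 : ℝ) 1) {k : ℕ}
    (g : Config (boxGraph d k) → ℝ) : ∃ l, Tendsto (fun n => boxEv d (n + k) p q
      (fun ω => g (pull (boxIncl (Nat.le_add_left k n)) ω))) atTop (𝓝 l) := by
  have hmono : ∀ g : Config (boxGraph d k) → ℝ, Monotone g →
      ∃ l, Tendsto (fun n => boxEv d (n + k) p q
        (fun ω => g (pull (boxIncl (Nat.le_add_left k n)) ω))) atTop (𝓝 l) := by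
    intro g hg
    obtain ⟨c, hc⟩ := (Set.finite_range g).bddBelow
    refine ⟨_, tendsto_atTop_ciInf (fun m n hmn => ?_) ⟨c, ?_⟩⟩
    · exact boxEv_pull_boxIncl_anti hd hq hp (Nat.le_add_left k m) (Nat.add_le_add_right hmn k) hg
    · rintro _ ⟨n, rfl⟩
      dsimp only
      rw [← boxEv_const (d := d) hp (zero_lt_one.trans_le hq) (n + k) c]
      exact boxEv_mono hp (zero_lt_one.trans_le hq) fun ω => hc ⟨_, rfl⟩
  obtain ⟨g₁, g₂, h1, h2, h⟩ := exists_monotone_sub g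
  obtain ⟨l₁, hl₁⟩ := hmono g₁ h1
  obtain ⟨l₂, hl₂⟩ := hmono g₂ h2
  refine ⟨l₁ - l₂, ?_⟩
  simp only [h, boxEv_sub]
  exact hl₁.sub hl₂

theorem pull_boxToLattice_extend {k n : ℕ} (h : k ≤ n) (ω : Config (boxGraph d n)) :
    pull (boxToLattice d k) (extend ω) = pull (boxIncl h) ω := by
  funext e
  have hval : Sym2.map Subtype.val (((boxIncl h).mapEdgeSet e : (boxGraph d n).edgeSet) :
      Sym2 (box d n)) = ((boxToLattice d k).mapEdgeSet e : Sym2 (Fin d → ℤ)) := by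
    obtain ⟨e, he⟩ := e
    induction e using Sym2.ind with | _ a b
    have hv : ∀ v : box d k, (boxIncl h v).1 = v.1 := fun v => by simp [boxIncl, boxEmb_val]
    change s((boxIncl h a).1, (boxIncl h b).1) = s(a.1, b.1)
    rw [hv, hv]
  change extend ω _ = ω _
  refine Bool.eq_iff_iff.2 ?_
  simp only [extend, decide_eq_true_eq]
  constructor
  · rintro ⟨f, hf, ho⟩
    have : f = (boxIncl h).mapEdgeSet e :=
      Subtype.ext (Sym2.map.injective Subtype.val_injective (hf.trans hval.symm))
    rwa [← this]
  · exact fun ho => ⟨_, hval, ho⟩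

theorem boxMeasure_real_extend (hp : p ∈ Set.Icc (0 : ℝ) 1) (hq : 0 < q) {k n : ℕ} (h : k ≤ n)
    (B : Set (Config (boxGraph d k))) :
    (boxMeasure d n p q).real {ω | extend ω ∈ pull (boxToLattice d k) ⁻¹' B} =
      boxEv d n p q (fun ω => ind B (pull (boxIncl h) ω)) := by
  have h1 : {ω : Config (boxGraph d n) | extend ω ∈ pull (boxToLattice d k) ⁻¹' B} =
      pull (boxIncl h) ⁻¹' B := by
    ext ω
    rw [Set.mem_ofPred_eq, Set.mem_preimage, Set.mem_preimage, pull_boxToLattice_extend h]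
  rw [h1, boxMeasure_real hp hq]
  rfl

/-- Finitely many edges lie in a common box, and every set of configurations of a finite box is
measurable. -/
theorem mem_measurableCylinders_iff (A : Set (Config (lattice d))) :
    A ∈ measurableCylinders (fun _ : (lattice d).edgeSet => Bool) ↔
      ∃ (k : ℕ) (B : Set (Config (boxGraph d k))), A = pull (boxToLattice d k) ⁻¹' B := by
  classical
  rw [mem_measurableCylinders]
  constructor
  · rintro ⟨s, S, -, rfl⟩
    have hedge : ∀ e : (lattice d).edgeSet, ∃ k, ∀ n, k ≤ n →
        ∃ e₀, (boxToLattice d n).mapEdgeSet e₀ = e := by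
      rintro ⟨e, he⟩
      induction e using Sym2.ind with | _ a b
      refine ⟨max (supAbs a) (supAbs b), fun n hn => ?_⟩
      have ha : a ∈ box d n := mem_box_iff_supAbs.2 ((le_max_left _ _).trans hn)
      have hb : b ∈ box d n := mem_box_iff_supAbs.2 ((le_max_right _ _).trans hn)
      exact ⟨⟨s(⟨a, ha⟩, ⟨b, hb⟩), he⟩, rfl⟩
    choose K hK using hedge
    have hs : ∀ e : s, ∃ e₀, (boxToLattice d (s.sup K)).mapEdgeSet e₀ = e.1 :=
      fun e => hK e.1 _ (Finset.le_sup e.2)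
    choose f hf using hs
    refine ⟨s.sup K, {ω | (fun e => ω (f e)) ∈ S}, ?_⟩
    ext ω
    have : s.restrict ω = fun e => pull (boxToLattice d (s.sup K)) ω (f e) := by
      funext e
      change ω e.1 = ω _
      rw [hf]
    rw [mem_cylinder, this]
    rfl
  · rintro ⟨k, B, rfl⟩
    refine ⟨Finset.univ.map (boxToLattice d k).mapEdgeSet,
      {x | (fun e => x ⟨(boxToLattice d k).mapEdgeSet e,
        Finset.mem_map_of_mem _ (Finset.mem_univ e)⟩) ∈ B}, Set.Finite.measurableSet
          (Set.toFinite _), rfl⟩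

instance instIsProbabilityMeasure_boxMeasure [Fact (p ∈ Set.Icc (0 : ℝ) 1)] [Fact (1 ≤ q)] (n : ℕ) :
    IsProbabilityMeasure (boxMeasure d n p q) := by
  have hp : p ∈ Set.Icc (0 : ℝ) 1 := Fact.out
  have hq : 0 < q := zero_lt_one.trans_le Fact.out
  rw [isProbabilityMeasure_iff_real, boxMeasure_real hp hq, ← boxEv_const (d := d) hp hq n 1]
  congr 1
  funext ω
  exact ind_of_mem (Set.mem_univ ω)

theorem isClopen_of_mem_measurableCylinders {A : Set (Config (lattice d))}
    (hA : A ∈ measurableCylinders (fun _ : (lattice d).edgeSet => Bool)) : IsClopen A := by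
  obtain ⟨k, B, rfl⟩ := (mem_measurableCylinders_iff A).1 hA
  have hc : Continuous (pull (boxToLattice d k)) := continuous_pi fun e => continuous_apply _
  exact (isClopen_discrete B).preimage hc

/-- The space of probability measures on the compact space `{0,1}^𝔼` is compact, so the box measures
converge along an ultrafilter. Cylinders are clopen, hence their probabilities converge too, and by
monotonicity in the box these probabilities already converge along the whole sequence, to the same
limit. -/
theorem exists_isWiredLimit (hd : 1 ≤ d) (hq : 1 ≤ q) (hp : p ∈ Set.Icc (0 : ℝ) 1) :
    ∃ φ, IsWiredLimit d p q φ := by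
  have : Fact (p ∈ Set.Icc (0 : ℝ) 1) := ⟨hp⟩
  have : Fact (1 ≤ q) := ⟨hq⟩
  have hmeas : ∀ n, Measurable (extend : Config (boxGraph d n) → Config (lattice d)) :=
    fun n => measurable_of_finite _
  let ν : ℕ → ProbabilityMeasure (Config (lattice d)) := fun n =>
    ⟨(boxMeasure d n p q).map extend, Measure.isProbabilityMeasure_map (hmeas n).aemeasurable⟩
  let F : Ultrafilter (ProbabilityMeasure (Config (lattice d))) := (hyperfilter ℕ).map ν
  have hF : Tendsto ν (hyperfilter ℕ : Filter ℕ) (𝓝 F.lim) := F.le_nhds_lim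
  refine ⟨(F.lim : Measure _), inferInstance, fun A hA => ?_⟩
  have hlim := ProbabilityMeasure.tendsto_measure_of_isClopen_of_tendsto hF
    (isClopen_of_mem_measurableCylinders hA)
  have hνA : ∀ n, ((ν n A : NNReal) : ℝ) = (boxMeasure d n p q).real {ω | extend ω ∈ A} := by
    intro n
    change ((boxMeasure d n p q).map extend).real A = _
    rw [Measure.real, Measure.map_apply (hmeas n) (MeasurableSet.of_mem_measurableCylinders hA)]
    rfl
  have hlim' : Tendsto (fun n => (boxMeasure d n p q).real {ω | extend ω ∈ A})
      (hyperfilter ℕ : Filter ℕ) (𝓝 ((F.lim : Measure _).real A)) := by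
    simp only [← hνA]
    exact (NNReal.tendsto_coe.2 hlim)
  obtain ⟨k, B, hB⟩ := (mem_measurableCylinders_iff A).1 hA
  obtain ⟨l, hl⟩ := exists_tendsto_boxEv hd hq hp (ind B)
  have hl' : Tendsto (fun n => (boxMeasure d n p q).real {ω | extend ω ∈ A}) atTop (𝓝 l) := by
    rw [← tendsto_add_atTop_iff_nat k]
    refine hl.congr fun n => ?_
    rw [hB, boxMeasure_real_extend hp (zero_lt_one.trans_le hq) (Nat.le_add_left k n)]
  have := tendsto_nhds_unique hlim' (hl'.mono_left Nat.hyperfilter_le_atTop)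
  rwa [this]

theorem isWiredLimit_wiredMeasure (hd : 1 ≤ d) (hq : 1 ≤ q) (hp : p ∈ Set.Icc (0 : ℝ) 1) :
    IsWiredLimit d p q (wiredMeasure d p q) := by
  have h := exists_isWiredLimit hd hq hp
  rw [wiredMeasure, dif_pos h]
  exact h.choose_spec

/-- The event that `0` is connected to `∂Λ_k` in `Λ_k`, for configurations on `ℤ^d`. -/
def latticeCrossing (d k : ℕ) : Set (Config (lattice d)) :=
  pull (boxToLattice d k) ⁻¹' crossing d k

theorem pull_boxToLattice_mem_crossing {k : ℕ} {ω : Config (lattice d)} {y : Fin d → ℤ}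
    (hr : (openGraph ω).Reachable 0 y) (hy : k ≤ supAbs y) (hd : 1 ≤ d) :
    ω ∈ latticeCrossing d k := by
  obtain ⟨i, hi⟩ := exists_natAbs_eq_supAbs hd y
  obtain ⟨b, hb, hr'⟩ := exists_reachable_boundary (c := id) Function.injective_id
    (fun _ _ h => h) (boxToLattice d k) (x := 0) (fun v => (zero_add v.1).symm)
    (u := origin d k) hr (i := i)
    (by simp only [id, Pi.zero_apply, sub_zero, Int.abs_eq_natAbs]; omega)
  exact mem_crossing.2 ⟨b, hb, hr'⟩

theorem exists_of_mem_latticeCrossing {k : ℕ} {ω : Config (lattice d)}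
    (h : ω ∈ latticeCrossing d k) : ∃ y, (openGraph ω).Reachable 0 y ∧ supAbs y = k := by
  obtain ⟨b, hb, hr⟩ := mem_crossing.1 h
  refine ⟨b.1, reachable_of_pull hr, le_antisymm (mem_box_iff_supAbs.1 b.2) ?_⟩
  obtain ⟨i, hi⟩ := mem_boxBoundary.1 hb
  have := natAbs_le_supAbs b.1 i
  rw [Int.abs_eq_natAbs] at hi
  omega

theorem latticeCrossing_antitone (hd : 1 ≤ d) : Antitone (latticeCrossing d) := by
  intro k n hkn ω hω
  obtain ⟨y, hr, hy⟩ := exists_of_mem_latticeCrossing hω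
  exact pull_boxToLattice_mem_crossing hr (by omega) hd

/-- Boxes are finite, so an infinite cluster leaves all of them; conversely a cluster reaching every
distance is infinite. -/
theorem iInter_latticeCrossing (hd : 1 ≤ d) :
    ⋂ k, latticeCrossing d k = connectedToInfinity (lattice d) 0 := by
  ext ω
  rw [Set.mem_iInter]
  constructor
  · intro h hfin
    have : Set.range (id : ℕ → ℕ) ⊆ supAbs '' {y | (openGraph ω).Reachable 0 y} := by
      rintro _ ⟨k, rfl⟩
      obtain ⟨y, hr, hy⟩ := exists_of_mem_latticeCrossing (h k)
      exact ⟨y, hr, hy⟩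
    have h2 := (hfin.image supAbs).subset this
    rw [Set.range_id] at h2
    exact Set.infinite_univ h2
  · intro h k
    have hfin : (box d k).Finite := Set.finite_Icc _ _
    obtain ⟨y, hr, hy⟩ := h.exists_notMem_finite hfin
    rw [mem_box_iff_supAbs] at hy
    exact pull_boxToLattice_mem_crossing hr (by omega) hd

theorem latticeCrossing_mem_measurableCylinders (k : ℕ) :
    latticeCrossing d k ∈ measurableCylinders (fun _ : (lattice d).edgeSet => Bool) :=
  (mem_measurableCylinders_iff _).2 ⟨k, _, rfl⟩

/-- The percolation probability `φ^1_{p,q}[0 ↔ ∞]`. -/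
noncomputable def percProb (d : ℕ) (q p : ℝ) : ℝ :=
  (wiredMeasure d p q).real (connectedToInfinity (lattice d) 0)

theorem isUpperSet_pull_crossing {n N : ℕ} (h : n ≤ N) :
    IsUpperSet {ω : Config (boxGraph d N) | pull (boxIncl h) ω ∈ crossing d n} :=
  (isUpperSet_crossing n).preimage (pull_mono _)

theorem tendsto_boxEv_latticeCrossing (hd : 1 ≤ d) (hq : 1 ≤ q) (hp : p ∈ Set.Icc (0 : ℝ) 1)
    (k : ℕ) : Tendsto (fun n => boxEv d (n + k) p q
      (ind {ω | pull (boxIncl (Nat.le_add_left k n)) ω ∈ crossing d k})) atTop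
      (𝓝 ((wiredMeasure d p q).real (latticeCrossing d k))) := by
  refine ((tendsto_add_atTop_iff_nat k).2 ((isWiredLimit_wiredMeasure hd hq hp).2 _
    (latticeCrossing_mem_measurableCylinders k))).congr fun n => ?_
  exact boxMeasure_real_extend hp (zero_lt_one.trans_le hq) (Nat.le_add_left k n) (crossing d k)

theorem wiredMeasure_latticeCrossing_le (hd : 1 ≤ d) (hq : 1 ≤ q) (hp : p ∈ Set.Icc (0 : ℝ) 1)
    (k : ℕ) : (wiredMeasure d p q).real (latticeCrossing d k) ≤ theta d q k p := by
  rw [theta_eq]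
  refine le_of_tendsto (tendsto_boxEv_latticeCrossing hd hq hp k) ?_
  filter_upwards [eventually_ge_atTop k] with n hn
  exact boxEv_ind_pull_anti hd hq hp (le_two_mul_self k) (by omega)

theorem theta_le_boxEv (hq : 1 ≤ q) (hp : p ∈ Set.Icc (0 : ℝ) 1) {k n : ℕ} (h : k ≤ n) :
    theta d q n p ≤ boxEv d (2 * n) p q
      (ind {ω | pull (boxIncl (h.trans (le_two_mul_self n))) ω ∈ crossing d k}) := by
  rw [theta_eq]
  refine boxEv_mono hp (zero_lt_one.trans_le hq) fun ω => ind_le_ind (fun ω hω => ?_) ω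
  have := pull_boxIncl_mem_crossing h hω
  rwa [pull_boxIncl_boxIncl] at this

theorem tendsto_wiredMeasure_latticeCrossing (hd : 1 ≤ d) (hq : 1 ≤ q)
    (hp : p ∈ Set.Icc (0 : ℝ) 1) :
    Tendsto (fun k => (wiredMeasure d p q).real (latticeCrossing d k)) atTop
      (𝓝 (percProb d q p)) := by
  have := (isWiredLimit_wiredMeasure hd hq hp).1
  have h := tendsto_measure_iInter_atTop (μ := wiredMeasure d p q) (s := latticeCrossing d)
    (fun k => (MeasurableSet.of_mem_measurableCylinders
      (latticeCrossing_mem_measurableCylinders k)).nullMeasurableSet)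
    (latticeCrossing_antitone hd) ⟨0, measure_ne_top _ _⟩
  rw [iInter_latticeCrossing hd] at h
  exact (ENNReal.tendsto_toReal (measure_ne_top _ _)).comp h

theorem percProb_le_theta (hd : 1 ≤ d) (hq : 1 ≤ q) (hp : p ∈ Set.Icc (0 : ℝ) 1) (n : ℕ) :
    percProb d q p ≤ theta d q n p := by
  have := (isWiredLimit_wiredMeasure hd hq hp).1
  refine le_trans ?_ (wiredMeasure_latticeCrossing_le hd hq hp n)
  refine measureReal_mono ?_ (measure_ne_top _ _)
  rw [← iInter_latticeCrossing hd]
  exact Set.iInter_subset _ n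

/-- The percolation probability is a lower bound for every `n`. For the upper bound, fix `k`: for
large `n`, `theta d q n p` is at most the probability of reaching `∂Λ_k` in a large box, which tends
to its infinite-volume value; then let `k` grow. -/
theorem tendsto_theta (hd : 1 ≤ d) (hq : 1 ≤ q) (hp : p ∈ Set.Icc (0 : ℝ) 1) :
    Tendsto (fun n => theta d q n p) atTop (𝓝 (percProb d q p)) := by
  rw [tendsto_order]
  refine ⟨fun a ha => Eventually.of_forall fun n => ha.trans_le (percProb_le_theta hd hq hp n),
    fun a ha => ?_⟩
  obtain ⟨k, hk⟩ := ((tendsto_order.1 (tendsto_wiredMeasure_latticeCrossing hd hq hp)).2 a ha).exists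
  have hk' := (tendsto_order.1 (tendsto_boxEv_latticeCrossing hd hq hp k)).2 a hk
  obtain ⟨N, hN⟩ := eventually_atTop.1 hk'
  filter_upwards [eventually_ge_atTop (N + k)] with n hn
  refine ((theta_le_boxEv hq hp (show k ≤ n by omega)).trans ?_).trans_lt (hN N le_rfl)
  exact boxEv_ind_pull_anti hd hq hp (Nat.le_add_left k N) (by omega)

theorem theta_anti (hd : 1 ≤ d) (hq : 1 ≤ q) (hp : p ∈ Set.Icc (0 : ℝ) 1) {k n : ℕ} (h : k ≤ n) :
    theta d q n p ≤ theta d q k p := by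
  rw [theta_eq d q k]
  exact (theta_le_boxEv hq hp h).trans (boxEv_ind_pull_anti hd hq hp (le_two_mul_self k) (by omega))

/-- Reaching `∂Λ_n` implies reaching `∂Λ_k`, and `Λ_n` contains `Λ_{2k}`, whose wired measure is
larger. -/
theorem boxEv_crossing_le_theta (hd : 1 ≤ d) (hq : 1 ≤ q) (hp : p ∈ Set.Icc (0 : ℝ) 1) {k n : ℕ}
    (h : 2 * k ≤ n) : boxEv d n p q (ind (crossing d n)) ≤ theta d q k p := by
  rw [theta_eq]
  have hkn : k ≤ n := by omega
  refine le_trans (boxEv_mono hp (zero_lt_one.trans_le hq) fun ω => ind_le_ind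
    (B := {ω | pull (boxIncl hkn) ω ∈ crossing d k})
    (fun ω hω => pull_boxIncl_mem_crossing hkn hω) ω) ?_
  exact boxEv_ind_pull_anti hd hq hp (le_two_mul_self k) h

theorem monotoneOn_theta (hq : 1 ≤ q) (n : ℕ) : MonotoneOn (theta d q n) (Set.Icc 0 1) := by
  classical
  refine (monotoneOn_ev_edgeWeight (boxClusterWeight_pos (zero_lt_one.trans_le hq))
    (boxClusterWeight_supermodular hq)
    (ind_mono (isUpperSet_pull_crossing (d := d) (le_two_mul_self n)))).congr fun t _ => ?_
  rw [theta_eq, boxEv_eq_ev]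

/-- An event that does not contain the configuration with all edges closed does not have
probability `1`. -/
theorem boxEv_ind_lt_one (hq : 1 ≤ q) (hp : p ∈ Set.Ico (0 : ℝ) 1) {n : ℕ}
    {A : Set (Config (boxGraph d n))} (hA : (fun _ => false) ∉ A) :
    boxEv d n p q (ind A) < 1 := by
  classical
  have hq0 := zero_lt_one.trans_le hq
  have hp' := Set.Ico_subset_Icc_self hp
  have hκ := boxClusterWeight_pos (d := d) (n := n) hq0
  have hs := sum_edgeWeight_pos hp' hκ
  rw [boxEv_eq_ev, ev, div_lt_one hs]
  refine Finset.sum_lt_sum (fun ω _ => mul_le_of_le_one_right (edgeWeight_nonneg hp' hκ ω)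
    (ind_le_one A ω)) ⟨fun _ => false, Finset.mem_univ _, ?_⟩
  rw [ind_of_notMem hA, mul_zero]
  simpa [edgeWeight] using mul_pos (pow_pos (sub_pos.2 hp.2) _) (hκ _)

theorem closed_notMem_crossing {n : ℕ} (hn : 1 ≤ n) : (fun _ => false) ∉ crossing d n := by
  intro h
  obtain ⟨b, hb, hr⟩ := mem_crossing.1 h
  have hbot : openGraph (fun _ => false : Config (boxGraph d n)) = ⊥ := by
    ext u v; simp [openGraph_adj]
  rw [hbot, SimpleGraph.reachable_bot] at hr
  obtain ⟨i, hi⟩ := mem_boxBoundary.1 hb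
  rw [← hr] at hi
  simp [origin] at hi
  omega

theorem theta_lt_one (hq : 1 ≤ q) (hp : p ∈ Set.Ico (0 : ℝ) 1) {n : ℕ} (hn : 1 ≤ n) :
    theta d q n p < 1 := by
  rw [theta_eq]
  exact boxEv_ind_lt_one hq hp (closed_notMem_crossing (d := d) hn)

theorem open_mem_crossing (hd : 1 ≤ d) (n : ℕ) : (fun _ => true) ∈ crossing d n := by
  let i : Fin d := ⟨0, hd⟩
  have hmem : ∀ k : ℕ, k ≤ n → (Pi.single i (k : ℤ) : Fin d → ℤ) ∈ box d n := by
    intro k hk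
    refine mem_box.2 fun j => ?_
    by_cases hj : j = i
    · subst hj; simpa using hk
    · simp [hj]
  have hreach : ∀ k (hk : k ≤ n), (openGraph (fun _ => true : Config (boxGraph d n))).Reachable
      (origin d n) ⟨_, hmem k hk⟩ := by
    intro k
    induction k with
    | zero =>
      intro hk
      have : (⟨_, hmem 0 hk⟩ : box d n) = origin d n := Subtype.ext (by simp [origin])
      rw [this]
    | succ k ih =>
      intro hk
      refine (ih (by omega)).trans (SimpleGraph.Adj.reachable (openGraph_adj.2 ⟨?_, rfl⟩))
      have h1 := lattice_adj_update (Pi.single i (k : ℤ) : Fin d → ℤ) i (σ := 1) (by simp)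
      change (lattice d).Adj (Pi.single i (k : ℤ)) (Pi.single i ((k + 1 : ℕ) : ℤ))
      convert h1 using 1
      funext j
      by_cases hj : j = i
      · subst hj; simp
      · simp [hj]
  exact mem_crossing.2 ⟨_, mem_boxBoundary.2 ⟨i, by simp⟩, hreach n le_rfl⟩

theorem ev_edgeWeight_one {E : Type*} [Fintype E] [DecidableEq E] {κ : (E → Bool) → ℝ}
    (hκ : ∀ ω, 0 < κ ω) (g : (E → Bool) → ℝ) :
    ev (edgeWeight 1 κ) g = g fun _ => true := by
  rw [← ev_const (sum_edgeWeight_pos (p := 1) (by simp) hκ) (g fun _ => true)]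
  refine ev_congr fun ω hω => congrArg g ?_
  by_contra hne
  obtain ⟨e, he⟩ := Function.ne_iff.1 hne
  refine hω ?_
  have : (Finset.univ.filter fun e => ω e = false).card ≠ 0 :=
    Finset.card_ne_zero_of_mem (Finset.mem_filter.2 ⟨Finset.mem_univ e, by simpa using he⟩)
  simp [edgeWeight, this]

/-- Makes the percolation probability equal to `1` at `p = 1`, so that the set defining `p_c` is
nonempty and `p_c ≤ 1`. -/
theorem theta_one (hd : 1 ≤ d) (hq : 1 ≤ q) (n : ℕ) : theta d q n 1 = 1 := by
  classical
  rw [theta_eq, boxEv_eq_ev, ev_edgeWeight_one (boxClusterWeight_pos (zero_lt_one.trans_le hq))]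
  exact ind_of_mem (open_mem_crossing hd n)

theorem theta_eq_one_of_eq_zero (hd : 1 ≤ d) (hq : 1 ≤ q) (hp : p ∈ Set.Icc (0 : ℝ) 1) {n : ℕ}
    (hn : n = 0) : theta d q n p = 1 := by
  have h0 : origin d n ∈ boxBoundary d n :=
    mem_boxBoundary.2 ⟨⟨0, hd⟩, by rw [hn]; simp [origin]⟩
  have h1 : ∀ ω : Config (boxGraph d n), ω ∈ crossing d n :=
    fun ω => mem_crossing.2 ⟨_, h0, .refl _⟩
  have h2 : (ind {ω | pull (boxIncl (le_two_mul_self n)) ω ∈ crossing d n}) = fun _ => 1 :=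
    funext fun ω => ind_of_mem (h1 _)
  rw [theta_eq, h2, boxEv_const hp (zero_lt_one.trans_le hq)]

end InfiniteVolume

/-! ### Analysis of the differential inequality -/

section DifferentialInequality

theorem mul_sub_le_of_hasDerivAt {g g' : ℝ → ℝ} {a b K : ℝ} (hab : a ≤ b)
    (hg : ∀ x ∈ Set.Icc a b, HasDerivAt g (g' x) x) (hK : ∀ x ∈ Set.Icc a b, K ≤ g' x) :
    K * (b - a) ≤ g b - g a := by
  refine Convex.mul_sub_le_image_sub_of_le_deriv (convex_Icc a b)
    (fun x hx => (hg x hx).continuousAt.continuousWithinAt) ?_ ?_ a (Set.left_mem_Icc.2 hab) b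
    (Set.right_mem_Icc.2 hab) hab
  · exact fun x hx =>
      (hg x (interior_subset hx)).differentiableAt.differentiableWithinAt
  · intro x hx
    rw [(hg x (interior_subset hx)).deriv]
    exact hK x (interior_subset hx)

/-- Grönwall's inequality, from the right. -/
theorem le_mul_exp_of_hasDerivAt {g g' : ℝ → ℝ} {a b K : ℝ} (hab : a ≤ b)
    (hg : ∀ x ∈ Set.Icc a b, HasDerivAt g (g' x) x)
    (hK : ∀ x ∈ Set.Icc a b, K * g x ≤ g' x) : g a ≤ g b * Real.exp (-(K * (b - a))) := by
  have hd : ∀ x ∈ Set.Icc a b, HasDerivAt (fun x => g x * Real.exp (-(K * (x - a))))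
      (g' x * Real.exp (-(K * (x - a))) + g x * (Real.exp (-(K * (x - a))) * -(K * 1))) x :=
    fun x hx => (hg x hx).mul ((((hasDerivAt_id x).sub_const a).const_mul K).neg.exp)
  have := mul_sub_le_of_hasDerivAt hab hd (K := 0) fun x hx => by
    have := mul_nonneg (sub_nonneg.2 (hK x hx)) (Real.exp_pos (-(K * (x - a)))).le
    linarith
  simp only [sub_self, mul_zero, neg_zero, Real.exp_zero, mul_one, zero_mul] at this
  linarith

variable {f : ℕ → ℝ → ℝ} {a b c : ℝ}

theorem one_le_partialSum {x : ℝ} (h0 : f 0 x = 1) (hf : ∀ n, 0 ≤ f n x) {n : ℕ} (hn : 1 ≤ n) :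
    1 ≤ ∑ i ∈ Finset.range n, f i x := by
  rw [← h0]
  exact Finset.single_le_sum (f := fun i => f i x) (fun i _ => hf i)
    (Finset.mem_range.2 (by omega))

/-- If the partial sums grow slower than linearly at `b`, there is exponential decay
below `b`. -/
theorem exists_exp_decay (hab : a < b) (hc : 0 < c) (h0 : ∀ x ∈ Set.Icc a b, f 0 x = 1)
    (h01 : ∀ n, ∀ x ∈ Set.Icc a b, f n x ∈ Set.Icc 0 1)
    (hmono : ∀ n, MonotoneOn (f n) (Set.Icc a b))
    (hderiv : ∀ n, 1 ≤ n → ∀ x ∈ Set.Icc a b, ∃ f', HasDerivAt (f n) f' x ∧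
      c * n * f n x ≤ (∑ i ∈ Finset.range n, f i x) * f')
    {ε : ℝ} (hε : 0 < ε)
    (hb : ∀ᶠ n : ℕ in atTop, ∑ i ∈ Finset.range n, f i b ≤ (n : ℝ) ^ (1 - ε)) :
    ∃ c' : ℝ, 0 < c' ∧ ∀ n : ℕ, 1 ≤ n → f n a ≤ Real.exp (-c' * n) := by
  -- On `[u, v]` the partial sum is at most its value at `v`, so the differential inequality yields
  -- `K f_n ≤ f_n'`.
  have gronwall : ∀ {u v : ℝ}, a ≤ u → u ≤ v → v ≤ b → ∀ {n : ℕ}, 1 ≤ n → ∀ {K : ℝ}, 0 ≤ K →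
      K * ∑ i ∈ Finset.range n, f i v ≤ c * n → f n u ≤ Real.exp (-(K * (v - u))) := by
    intro u v hau huv hvb n hn K hK0 hK
    have hsub : ∀ x ∈ Set.Icc u v, x ∈ Set.Icc a b := fun x hx => ⟨hau.trans hx.1, hx.2.trans hvb⟩
    choose! f' hf' hle using hderiv n hn
    refine (le_mul_exp_of_hasDerivAt (K := K) huv (fun x hx => hf' x (hsub x hx))
      fun x hx => ?_).trans
      (mul_le_of_le_one_left (Real.exp_pos _).le (h01 n v ⟨hau.trans huv, hvb⟩).2)
    have hx' := hsub x hx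
    have hS := one_le_partialSum (h0 x hx') (fun i => (h01 i x hx').1) hn
    have hSv : ∑ i ∈ Finset.range n, f i x ≤ ∑ i ∈ Finset.range n, f i v :=
      Finset.sum_le_sum fun i _ => hmono i hx' ⟨hau.trans huv, hvb⟩ hx.2
    have h1 : K * ∑ i ∈ Finset.range n, f i x ≤ c * n :=
      (mul_le_mul_of_nonneg_left hSv hK0).trans hK
    have h2 := mul_le_mul_of_nonneg_right h1 (h01 n x hx').1
    have h3 := h2.trans (hle x hx')
    refine le_of_mul_le_mul_left ?_ (zero_lt_one.trans_le hS)
    linarith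
  set m := (a + b) / 2 with hm
  have ham : a < m := by rw [hm]; linarith
  have hmb : m < b := by rw [hm]; linarith
  -- First pass, from `b` down to the midpoint with `K = c n^ε`: the decay `exp(-c (b - m) n^ε)` is
  -- summable.
  have hsum : Summable fun n => f n m := by
    set δ := c * (b - m) with hδ
    have hδ0 : 0 < δ := mul_pos hc (sub_pos.2 hmb)
    have hO : (fun n => f n m) =O[atTop] fun n : ℕ => (n : ℝ) ^ (-2 : ℝ) := by
      have h1 := (isLittleO_exp_neg_mul_rpow_atTop hδ0 (-2 / ε)).isBigO.comp_tendsto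
        ((tendsto_rpow_atTop hε).comp tendsto_natCast_atTop_atTop)
      have h2 : (fun n : ℕ => (n : ℝ) ^ (-2 : ℝ)) =
          (fun x : ℝ => x ^ (-2 / ε)) ∘ ((fun x : ℝ => x ^ ε) ∘ (Nat.cast : ℕ → ℝ)) := by
        funext n
        simp only [Function.comp]
        rw [← Real.rpow_mul n.cast_nonneg, mul_div_cancel₀ _ hε.ne']
      rw [h2]
      refine Asymptotics.IsBigO.trans (Asymptotics.IsBigO.of_bound 1 ?_) h1
      filter_upwards [hb, eventually_ge_atTop 1] with n hn hn1
      have hn0 : (0 : ℝ) < n := by exact_mod_cast hn1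
      rw [one_mul, Real.norm_of_nonneg (h01 n m ⟨ham.le, hmb.le⟩).1,
        Function.comp_apply, Real.norm_of_nonneg (Real.exp_pos _).le]
      refine (gronwall ham.le hmb.le le_rfl hn1 (K := c * (n : ℝ) ^ ε)
        (mul_nonneg hc.le (Real.rpow_nonneg hn0.le _)) ?_).trans (le_of_eq ?_)
      · have h3 : (n : ℝ) ^ ε * (n : ℝ) ^ (1 - ε) = n := by
          rw [← Real.rpow_add hn0]; simp
        calc c * (n : ℝ) ^ ε * ∑ i ∈ Finset.range n, f i b
            ≤ c * (n : ℝ) ^ ε * (n : ℝ) ^ (1 - ε) :=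
              mul_le_mul_of_nonneg_left hn (mul_nonneg hc.le (Real.rpow_nonneg hn0.le _))
          _ = c * n := by rw [mul_assoc, h3]
      · congr 1
        simp only [Function.comp, hδ]
        ring
    exact summable_of_isBigO_nat (Real.summable_nat_rpow.2 (by norm_num)) hO
  set M := ∑' n, f n m with hM
  have hmem : m ∈ Set.Icc a b := ⟨ham.le, hmb.le⟩
  have hle : ∀ n, ∑ i ∈ Finset.range n, f i m ≤ M := fun n =>
    hsum.sum_le_tsum _ fun i _ => (h01 i m hmem).1
  have hM0 : 0 < M := zero_lt_one.trans_le
    ((one_le_partialSum (h0 m hmem) (fun i => (h01 i m hmem).1) le_rfl).trans (hle 1))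
  -- Second pass, from `m` down to `a`: the partial sums at `m` are now bounded by `M`, so `K = c n
  -- / M` is linear in `n`.
  refine ⟨c / M * (m - a), mul_pos (div_pos hc hM0) (sub_pos.2 ham), fun n hn => ?_⟩
  refine (gronwall le_rfl ham.le hmb.le hn (K := c * n / M) (by positivity) ?_).trans
    (le_of_eq ?_)
  · calc c * n / M * ∑ i ∈ Finset.range n, f i m ≤ c * n / M * M :=
          mul_le_mul_of_nonneg_left (hle n) (by positivity)
      _ = c * n := div_mul_cancel₀ _ hM0.ne'
  · congr 1
    ring

/-- If the partial sums grow almost linearly at `a`, the limit grows at least linearly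
above `a`. -/
theorem mul_sub_le_limit (hab : a ≤ b) (hc : 0 < c) (h0 : ∀ x ∈ Set.Icc a b, f 0 x = 1)
    (h01 : ∀ n, ∀ x ∈ Set.Icc a b, f n x ∈ Set.Icc 0 1)
    (hmono : ∀ n, MonotoneOn (f n) (Set.Icc a b))
    (hderiv : ∀ n, 1 ≤ n → ∀ x ∈ Set.Icc a b, ∃ f', HasDerivAt (f n) f' x ∧
      c * n * f n x ≤ (∑ i ∈ Finset.range n, f i x) * f')
    {L : ℝ} (hL : Tendsto (fun n => f n b) atTop (𝓝 L))
    (ha : ∀ ε : ℝ, 0 < ε → ∃ᶠ n : ℕ in atTop,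
      (1 - ε) * Real.log n ≤ Real.log (∑ i ∈ Finset.range (n + 1), f i a)) :
    c * (b - a) ≤ L := by
  have hamem : a ∈ Set.Icc a b := Set.left_mem_Icc.2 hab
  have hbmem : b ∈ Set.Icc a b := Set.right_mem_Icc.2 hab
  set S : ℕ → ℝ → ℝ := fun n x => ∑ i ∈ Finset.range n, f i x with hS
  have hS1 : ∀ n, 1 ≤ n → ∀ x ∈ Set.Icc a b, 1 ≤ S n x := fun n hn x hx =>
    one_le_partialSum (h0 x hx) (fun i => (h01 i x hx).1) hn
  -- The logarithmic average of the `f i` for `1 ≤ i ≤ n`, not yet divided by `log n`.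
  set T : ℕ → ℝ → ℝ := fun n x => ∑ i ∈ Finset.range n, f (i + 1) x / ((i : ℝ) + 1) with hT
  have lower : ∀ n, c * Real.log (S (n + 1) a) * (b - a) ≤ T n b := by
    intro n
    choose! f' hf' hle using hderiv
    have hd : ∀ x ∈ Set.Icc a b, HasDerivAt (T n)
        (∑ i ∈ Finset.range n, f' (i + 1) x / ((i : ℝ) + 1)) x := fun x hx =>
      HasDerivAt.fun_sum fun i _ => (hf' (i + 1) (by omega) x hx).div_const _
    have h1 := mul_sub_le_of_hasDerivAt hab hd (K := c * Real.log (S (n + 1) a)) fun x hx => by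
      have hlog : Real.log (S (n + 1) a) ≤ Real.log (S (n + 1) x) :=
        Real.log_le_log (zero_lt_one.trans_le (hS1 _ (by omega) a hamem))
          (Finset.sum_le_sum fun i _ => hmono i hamem hx hx.1)
      -- The sum telescopes from `log S_1 = log (f 0) = 0`. Each increment is at most `f_i / S_i`,
      -- which the differential inequality bounds by `f_i' / (c i)`.
      have htel : Real.log (S (n + 1) x) =
          ∑ i ∈ Finset.range n, (Real.log (S (i + 2) x) - Real.log (S (i + 1) x)) := by
        rw [Finset.sum_range_sub (fun i => Real.log (S (i + 1) x))]
        simp [hS, h0 x hx]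
      refine (mul_le_mul_of_nonneg_left hlog hc.le).trans ?_
      rw [htel, Finset.mul_sum]
      refine Finset.sum_le_sum fun i _ => ?_
      have hp1 : 0 < S (i + 1) x := zero_lt_one.trans_le (hS1 _ (by omega) x hx)
      have hp2 : 0 < S (i + 2) x := zero_lt_one.trans_le (hS1 _ (by omega) x hx)
      have hstep : S (i + 2) x = S (i + 1) x + f (i + 1) x := Finset.sum_range_succ _ _
      have h2 : Real.log (S (i + 2) x) - Real.log (S (i + 1) x) ≤ f (i + 1) x / S (i + 1) x := by
        rw [← Real.log_div hp2.ne' hp1.ne']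
        refine (Real.log_le_sub_one_of_pos (div_pos hp2 hp1)).trans (le_of_eq ?_)
        rw [hstep]; field_simp; ring
      refine (mul_le_mul_of_nonneg_left h2 hc.le).trans ?_
      have h3 := hle (i + 1) (by omega) x hx
      have hi : (0 : ℝ) < (i : ℝ) + 1 := by positivity
      rw [← mul_div_assoc, div_le_div_iff₀ hp1 hi]
      push_cast at h3
      change _ ≤ S (i + 1) x * _ at h3
      linarith
    have hTa : 0 ≤ T n a := Finset.sum_nonneg fun i _ =>
      div_nonneg (h01 _ a hamem).1 (by positivity)
    linarith
  by_contra hcon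
  push Not at hcon
  have hL0 : 0 ≤ L := ge_of_tendsto' hL fun n => (h01 n b hbmem).1
  set D := c * (b - a) with hD
  have hD0 : 0 < D := hL0.trans_lt hcon
  -- Chosen so that `D (1 - ε) - (L + ε) = (D - L) / 2`: the lower and upper bounds on `T n b`, both
  -- of order `log n`, then contradict each other if `L < D`.
  set ε := (D - L) / (2 * (D + 1)) with hε
  have hε0 : 0 < ε := div_pos (sub_pos.2 hcon) (by positivity)
  have hεD : (D + 1) * ε = (D - L) / 2 := by rw [hε]; field_simp
  obtain ⟨N, hN⟩ := eventually_atTop.1 ((tendsto_order.1 hL).2 (L + ε) (by linarith))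
  -- Terms with `i < N` are at most `1` each; the others are at most `(L + ε) / (i + 1)`, a harmonic
  -- sum.
  have upper : ∀ n, T n b ≤ N + (L + ε) * (1 + Real.log n) := by
    intro n
    have h1 : T n b ≤ ∑ i ∈ Finset.range n,
        ((if i < N then 1 else 0) + (L + ε) * ((i : ℝ) + 1)⁻¹) := by
      refine Finset.sum_le_sum fun i _ => ?_
      have hi : (0 : ℝ) < (i : ℝ) + 1 := by positivity
      split_ifs with h
      · have : f (i + 1) b / ((i : ℝ) + 1) ≤ 1 := by
          rw [div_le_one hi]
          have : (0 : ℝ) ≤ i := i.cast_nonneg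
          linarith [(h01 (i + 1) b hbmem).2]
        have : 0 ≤ (L + ε) * ((i : ℝ) + 1)⁻¹ := by positivity
        linarith
      · rw [zero_add, div_eq_mul_inv]
        exact mul_le_mul_of_nonneg_right (hN _ (by omega)).le (by positivity)
    refine h1.trans ?_
    rw [Finset.sum_add_distrib, ← Finset.mul_sum]
    refine add_le_add ?_ (mul_le_mul_of_nonneg_left ?_ (by positivity))
    · rw [Finset.sum_boole]
      have : (Finset.range n).filter (· < N) ⊆ Finset.range N := fun i hi =>
        Finset.mem_range.2 (Finset.mem_filter.1 hi).2
      exact_mod_cast (Finset.card_le_card this).trans (Finset.card_range N).le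
    · have := harmonic_le_one_add_log n
      rw [harmonic] at this
      push_cast at this
      exact this
  have hlogt : Tendsto (fun n : ℕ => (D - L) / 2 * Real.log n) atTop atTop :=
    (Real.tendsto_log_atTop.comp tendsto_natCast_atTop_atTop).const_mul_atTop
      (by linarith)
  obtain ⟨n, hn1, hn2⟩ := ((ha ε hε0).and_eventually
    (hlogt.eventually_gt_atTop (N + (L + ε)))).exists
  have h1 := (lower n).trans (upper n)
  have h2 := mul_le_mul_of_nonneg_left hn1 hD0.le
  have h3 : c * Real.log (S (n + 1) a) * (b - a) = D * Real.log (S (n + 1) a) := by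
    rw [hD]; ring
  rw [h3] at h1
  change _ ≤ D * Real.log (S (n + 1) a) at h2
  have h4 : (D - L) / 2 * Real.log n = D * ((1 - ε) * Real.log n) - (L + ε) * Real.log n := by
    rw [show (D - L) / 2 = D - L - (D + 1) * ε by rw [hεD]; ring]; ring
  linarith

end DifferentialInequality

/-! ### The phase transition at the critical parameter -/

section Sharpness

variable {d : ℕ} {q p : ℝ}

/-- The factor `1 - theta d q n x` is at least `1 - theta d q 1 p₀`, because `theta` decreases in
`n` and increases in the edge-weight. This constant is uniform on `(0, p₀]`. -/
theorem theta_differential_inequality (hd : 1 ≤ d) (hq : 1 ≤ q) {p₀ : ℝ}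
    (hp₀ : p₀ ∈ Set.Ioo (0 : ℝ) 1) {n : ℕ} (hn : 1 ≤ n) {x : ℝ} (hx : x ∈ Set.Ioc 0 p₀) :
    ∃ θ', HasDerivAt (theta d q n) θ' x ∧
      (1 - theta d q 1 p₀) / 8 * n * theta d q n x ≤
        (∑ i ∈ Finset.range n, theta d q i x) * θ' := by
  have hx' : x ∈ Set.Ioo (0 : ℝ) 1 := ⟨hx.1, hx.2.trans_lt hp₀.2⟩
  have hx'' := Set.Ioo_subset_Icc_self hx'
  obtain ⟨θ', h1, h2⟩ := hasDerivAt_theta hd hq hx' n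
  refine ⟨θ', h1, ?_⟩
  have h3 : theta d q n x ≤ theta d q 1 p₀ :=
    (theta_anti hd hq hx'' hn).trans
      (monotoneOn_theta hq 1 hx'' (Set.Ioo_subset_Icc_self hp₀) hx.2)
  have h4 := mul_le_mul_of_nonneg_left (sub_le_sub_left h3 1)
    (mul_nonneg n.cast_nonneg (theta_mem_Icc (d := d) hq hx'' n).1)
  linarith

theorem percProb_mono (hd : 1 ≤ d) (hq : 1 ≤ q) : MonotoneOn (percProb d q) (Set.Icc 0 1) :=
  fun _ hx _ hy hxy => le_of_tendsto_of_tendsto' (tendsto_theta hd hq hx) (tendsto_theta hd hq hy)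
    fun n => monotoneOn_theta hq n hx hy hxy

theorem percProb_one (hd : 1 ≤ d) (hq : 1 ≤ q) : percProb d q 1 = 1 :=
  tendsto_nhds_unique (tendsto_theta hd hq (by simp))
    (tendsto_const_nhds.congr fun n => (theta_one hd hq n).symm)

theorem criticalParameter_eq (d : ℕ) (q : ℝ) :
    criticalParameter d q = sInf {p : ℝ | 0 < p ∧ p ≤ 1 ∧ 0 < percProb d q p} := rfl

theorem bddBelow_percolating (d : ℕ) (q : ℝ) :
    BddBelow {p : ℝ | 0 < p ∧ p ≤ 1 ∧ 0 < percProb d q p} := ⟨0, fun _ h => h.1.le⟩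

theorem one_mem_percolating (hd : 1 ≤ d) (hq : 1 ≤ q) :
    (1 : ℝ) ∈ {p : ℝ | 0 < p ∧ p ≤ 1 ∧ 0 < percProb d q p} :=
  ⟨one_pos, le_rfl, by rw [percProb_one hd hq]; exact one_pos⟩

theorem criticalParameter_mem_Icc (hd : 1 ≤ d) (hq : 1 ≤ q) :
    criticalParameter d q ∈ Set.Icc 0 1 := by
  rw [criticalParameter_eq]
  exact ⟨Real.sInf_nonneg fun _ h => h.1.le,
    csInf_le (bddBelow_percolating d q) (one_mem_percolating hd hq)⟩

theorem percProb_eq_zero (hd : 1 ≤ d) (hq : 1 ≤ q) (hp : 0 < p)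
    (h : p < criticalParameter d q) : percProb d q p = 0 := by
  have h1 := h.trans_le (criticalParameter_mem_Icc hd hq).2
  by_contra hne
  have hpos : 0 < percProb d q p := lt_of_le_of_ne measureReal_nonneg (Ne.symm hne)
  rw [criticalParameter_eq] at h
  exact notMem_of_lt_csInf h (bddBelow_percolating d q) ⟨hp, h1.le, hpos⟩

theorem percProb_pos (hd : 1 ≤ d) (hq : 1 ≤ q) (hp : p ≤ 1)
    (h : criticalParameter d q < p) : 0 < percProb d q p := by
  rw [criticalParameter_eq] at h
  obtain ⟨x, ⟨hx0, hx1, hx⟩, hxp⟩ := exists_lt_of_csInf_lt ⟨1, one_mem_percolating hd hq⟩ h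
  exact hx.trans_le (percProb_mono hd hq ⟨hx0.le, hx1⟩ ⟨hx0.le.trans hxp.le, hp⟩ hxp.le)

theorem mul_sub_le_percProb (hd : 1 ≤ d) (hq : 1 ≤ q) {p₀ a b : ℝ} (hp₀ : p₀ ∈ Set.Ioo (0 : ℝ) 1)
    (ha : 0 < a) (hab : a ≤ b) (hb : b ≤ p₀)
    (h : ∀ ε : ℝ, 0 < ε → ∃ᶠ n : ℕ in atTop,
      (1 - ε) * Real.log n ≤ Real.log (∑ i ∈ Finset.range (n + 1), theta d q i a)) :
    (1 - theta d q 1 p₀) / 8 * (b - a) ≤ percProb d q b := by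
  have hI : ∀ x ∈ Set.Icc a b, x ∈ Set.Icc (0 : ℝ) 1 := fun x hx =>
    ⟨ha.le.trans hx.1, hx.2.trans (hb.trans hp₀.2.le)⟩
  have hδ := theta_lt_one (d := d) hq (Set.Ioo_subset_Ico_self hp₀) le_rfl
  exact mul_sub_le_limit hab (by linarith) (fun x hx => theta_eq_one_of_eq_zero hd hq (hI x hx) rfl)
    (fun n x hx => theta_mem_Icc hq (hI x hx) n) (fun n => (monotoneOn_theta hq n).mono hI)
    (fun n hn x hx => theta_differential_inequality hd hq hp₀ hn
      ⟨ha.trans_le hx.1, hx.2.trans hb⟩)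
    (tendsto_theta hd hq (hI b (Set.right_mem_Icc.2 hab))) h

theorem exists_theta_exp_decay (hd : 1 ≤ d) (hq : 1 ≤ q) (hp : 0 ≤ p)
    (h : p < criticalParameter d q) :
    ∃ c : ℝ, 0 < c ∧ ∀ n : ℕ, 1 ≤ n → theta d q n p ≤ Real.exp (-c * n) := by
  have hpc := (criticalParameter_mem_Icc hd hq).2
  -- The order is `p < a < b < p₀ < p_c`. Passing to `a` makes the parameter positive, as the
  -- differential inequality requires, and the gap between `b` and `p₀` gives room for the
  -- contradiction below.
  obtain ⟨a, hpa, ha⟩ := exists_between h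
  obtain ⟨b, hab, hb⟩ := exists_between ha
  obtain ⟨p₀, hbp, hp₀⟩ := exists_between hb
  have ha0 : 0 < a := hp.trans_lt hpa
  have hp₀' : p₀ ∈ Set.Ioo (0 : ℝ) 1 := ⟨by linarith, by linarith⟩
  have hδ := theta_lt_one (d := d) hq (Set.Ioo_subset_Ico_self hp₀') le_rfl
  have hI : ∀ x ∈ Set.Icc a b, x ∈ Set.Icc (0 : ℝ) 1 := fun x hx =>
    ⟨ha0.le.trans hx.1, by linarith [hx.2]⟩
  -- Otherwise the partial sums grow almost linearly at `b`, and the percolation probability would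
  -- be positive at `p₀ < p_c`.
  have hslow : ∃ ε : ℝ, 0 < ε ∧ ∀ᶠ n : ℕ in atTop,
      Real.log (∑ i ∈ Finset.range (n + 1), theta d q i b) < (1 - ε) * Real.log n := by
    by_contra hcon
    push Not at hcon
    have h1 := mul_sub_le_percProb hd hq hp₀' (ha0.trans hab) hbp.le le_rfl hcon
    rw [percProb_eq_zero hd hq hp₀'.1 hp₀] at h1
    have : 0 < (1 - theta d q 1 p₀) / 8 * (p₀ - b) := mul_pos (by linarith) (by linarith)
    linarith
  obtain ⟨ε, hε, hslow⟩ := hslow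
  obtain ⟨c, hc, hdecay⟩ := exists_exp_decay (f := theta d q) hab
    (c := (1 - theta d q 1 p₀) / 8) (by linarith)
    (fun x hx => theta_eq_one_of_eq_zero hd hq (hI x hx) rfl)
    (fun n x hx => theta_mem_Icc hq (hI x hx) n) (fun n => (monotoneOn_theta hq n).mono hI)
    (fun n hn x hx => theta_differential_inequality hd hq hp₀' hn
      ⟨ha0.trans_le hx.1, hx.2.trans hbp.le⟩) hε (by
      filter_upwards [hslow, eventually_ge_atTop 1] with n hn hn1
      have hbm : b ∈ Set.Icc a b := Set.right_mem_Icc.2 hab.le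
      have hn0 : (0 : ℝ) < n := by exact_mod_cast hn1
      have h1 := one_le_partialSum (f := theta d q)
        (theta_eq_one_of_eq_zero hd hq (hI b hbm) rfl)
        (fun i => (theta_mem_Icc hq (hI b hbm) i).1) (Nat.le_add_left 1 n)
      have h2 : ∑ i ∈ Finset.range n, theta d q i b ≤
          ∑ i ∈ Finset.range (n + 1), theta d q i b := by
        rw [Finset.sum_range_succ]
        linarith [(theta_mem_Icc (d := d) hq (hI b hbm) n).1]
      refine h2.trans ?_
      rw [Real.rpow_def_of_pos hn0, mul_comm, ← Real.log_le_iff_le_exp (by linarith)]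
      exact hn.le)
  refine ⟨c, hc, fun n hn => ?_⟩
  exact (monotoneOn_theta hq n ⟨hp, by linarith⟩ (hI a (Set.left_mem_Icc.2 hab.le)) hpa.le).trans
    (hdecay n hn)

theorem boxEv_crossing_exp_decay (hd : 1 ≤ d) (hq : 1 ≤ q) (hp : 0 ≤ p)
    (h : p < criticalParameter d q) :
    ∃ c : ℝ, 0 < c ∧ ∀ n : ℕ, 1 ≤ n →
      boxEv d n p q (ind (crossing d n)) ≤ Real.exp (-c * n) := by
  have hp1 : p < 1 := h.trans_le (criticalParameter_mem_Icc hd hq).2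
  obtain ⟨c, hc, hdecay⟩ := exists_theta_exp_decay hd hq hp h
  have h1 : boxEv d 1 p q (ind (crossing d 1)) < 1 :=
    boxEv_ind_lt_one hq ⟨hp, hp1⟩ (closed_notMem_crossing le_rfl)
  -- The case `n = 1` is not covered by the decay of `theta`, since `1 / 2` rounds down to `0`;
  -- there a probability less than `1` suffices. The `1 / 2` in the maximum keeps the logarithm
  -- meaningful.
  set r := max (boxEv d 1 p q (ind (crossing d 1))) (1 / 2) with hr
  have hr0 : 0 < r := lt_max_of_lt_right (by norm_num)
  have hr1 : r < 1 := max_lt h1 (by norm_num)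
  have hlog : 0 < -Real.log r := neg_pos.2 (Real.log_neg hr0 hr1)
  refine ⟨min (c / 3) (-Real.log r), lt_min (by positivity) hlog, fun n hn => ?_⟩
  rcases hn.eq_or_lt with rfl | hn2
  · refine (le_max_left _ (1 / 2 : ℝ)).trans ?_
    rw [← hr, ← Real.log_le_iff_le_exp hr0]
    have := min_le_right (c / 3) (-Real.log r)
    push_cast
    linarith
  · refine (boxEv_crossing_le_theta hd hq ⟨hp, hp1.le⟩ (Nat.mul_div_le n 2)).trans
      ((hdecay (n / 2) (by omega)).trans (Real.exp_le_exp.2 ?_))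
    -- For `n ≥ 2`, `⌊n/2⌋ ≥ n/3`, which explains the rate `c / 3`.
    have h2 : (n : ℝ) ≤ 3 * ((n / 2 : ℕ) : ℝ) := by
      exact_mod_cast (show n ≤ 3 * (n / 2) by omega)
    have h3 := mul_le_mul_of_nonneg_right (min_le_left (c / 3) (-Real.log r))
      (n.cast_nonneg : (0 : ℝ) ≤ n)
    have h4 := mul_le_mul_of_nonneg_left h2 hc.le
    linarith

theorem percProb_mean_field (hd : 1 ≤ d) (hq : 1 ≤ q) :
    ∃ c : ℝ, 0 < c ∧ ∀ p ∈ Set.Icc (0 : ℝ) 1, criticalParameter d q < p →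
      c * (p - criticalParameter d q) ≤ percProb d q p := by
  obtain ⟨hpc0, hpc1⟩ := criticalParameter_mem_Icc hd hq
  set pc := criticalParameter d q with hpc
  rcases hpc1.eq_or_lt with heq | hlt
  · exact ⟨1, one_pos, fun p hp h => absurd hp.2 (by linarith)⟩
  -- The constant of the differential inequality degenerates at `1`, so the linear bound is proved
  -- up to `p₀` and extended beyond by monotonicity. Since `p - pc ≤ 1 - pc = 2 (p₀ - pc)`, this
  -- costs a factor `2`.
  set p₀ := (pc + 1) / 2 with hp₀
  have hp₀' : p₀ ∈ Set.Ioo (0 : ℝ) 1 := ⟨by linarith, by linarith⟩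
  have hδ := theta_lt_one (d := d) hq (Set.Ioo_subset_Ico_self hp₀') le_rfl
  have hδ' : 0 < (1 - theta d q 1 p₀) / 8 := by linarith
  refine ⟨(1 - theta d q 1 p₀) / 8 / 2, by linarith, fun p hp h => ?_⟩
  set b := min p p₀ with hb
  have hbpc : pc < b := lt_min h (by linarith)
  have hb1 : b ≤ 1 := (min_le_left _ _).trans hp.2
  -- Above `p_c` each `theta d q i a` is at least the positive percolation probability at `a`, so
  -- the partial sums grow linearly. Nothing is known at `p_c` itself, hence the limit `a → p_c`
  -- afterwards.
  have key : ∀ a ∈ Set.Ioo pc b, (1 - theta d q 1 p₀) / 8 * (b - a) ≤ percProb d q b := by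
    intro a ha
    have ha0 : 0 < a := hpc0.trans_lt ha.1
    have ha1 : a ≤ 1 := ha.2.le.trans hb1
    have hpos : 0 < percProb d q a := percProb_pos hd hq ha1 ha.1
    refine mul_sub_le_percProb hd hq hp₀' ha0 ha.2.le (min_le_right _ _) fun ε hε =>
      Eventually.frequently ?_
    have hlogt : Tendsto (fun n : ℕ => ε * Real.log n) atTop atTop :=
      (Real.tendsto_log_atTop.comp tendsto_natCast_atTop_atTop).const_mul_atTop hε
    filter_upwards [hlogt.eventually_ge_atTop (-Real.log (percProb d q a)),
      eventually_ge_atTop 1] with n hn hn1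
    have hn0 : (0 : ℝ) < n := by exact_mod_cast hn1
    have hsum : n * percProb d q a ≤ ∑ i ∈ Finset.range (n + 1), theta d q i a := by
      have h1 : ∑ i ∈ Finset.range (n + 1), percProb d q a ≤
          ∑ i ∈ Finset.range (n + 1), theta d q i a :=
        Finset.sum_le_sum fun i _ => percProb_le_theta hd hq ⟨ha0.le, ha1⟩ i
      rw [Finset.sum_const, Finset.card_range, nsmul_eq_mul] at h1
      push_cast at h1
      linarith
    refine le_trans ?_ (Real.log_le_log (mul_pos hn0 hpos) hsum)
    rw [Real.log_mul hn0.ne' hpos.ne']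
    linarith
  have hlim : (1 - theta d q 1 p₀) / 8 * (b - pc) ≤ percProb d q b := by
    have ht : Tendsto (fun a => (1 - theta d q 1 p₀) / 8 * (b - a)) (𝓝[>] pc)
        (𝓝 ((1 - theta d q 1 p₀) / 8 * (b - pc))) := by
      have : Continuous fun a => (1 - theta d q 1 p₀) / 8 * (b - a) := by fun_prop
      exact (this.tendsto pc).mono_left nhdsWithin_le_nhds
    refine le_of_tendsto ht ?_
    filter_upwards [Ioo_mem_nhdsGT hbpc] with a ha using key a ha
  have hbp : (p - pc) / 2 ≤ b - pc := by
    rcases min_cases p p₀ with ⟨h1, -⟩ | ⟨h1, -⟩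
    · rw [hb, h1]; linarith
    · rw [hb, h1, hp₀]; linarith [hp.2]
  have h1 := mul_le_mul_of_nonneg_left hbp hδ'.le
  have h2 := percProb_mono hd hq ⟨hpc0.trans hbpc.le, hb1⟩ hp (min_le_left p p₀)
  linarith

end Sharpness

end RandomCluster

theorem mainTheorem1 (d : ℕ) (hd : 1 ≤ d) (q : ℝ) (hq : 1 ≤ q) :
    -- the infinite-volume limit that defines `φ^1_{p,q}` exists for every edge-weight `p`
    (∀ p ∈ Set.Icc (0 : ℝ) 1,
      RandomCluster.IsWiredLimit d p q (RandomCluster.wiredMeasure d p q)) ∧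
    -- mean-field lower bound for `p > p_c`
    (∃ c : ℝ, 0 < c ∧ ∀ p ∈ Set.Icc (0 : ℝ) 1, RandomCluster.criticalParameter d q < p →
      c * (p - RandomCluster.criticalParameter d q) ≤
        (RandomCluster.wiredMeasure d p q).real
          (RandomCluster.connectedToInfinity (RandomCluster.lattice d) 0)) ∧
    -- exponential decay for `p < p_c`
    (∀ p ∈ Set.Icc (0 : ℝ) 1, p < RandomCluster.criticalParameter d q →
      ∃ c : ℝ, 0 < c ∧ ∀ n : ℕ, 1 ≤ n →
        (RandomCluster.boxMeasure d n p q).real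
            (RandomCluster.connected (RandomCluster.boxGraph d n)
              {RandomCluster.origin d n} (RandomCluster.boxBoundary d n)) ≤
          Real.exp (-c * n)) := by
  refine ⟨fun p hp => RandomCluster.isWiredLimit_wiredMeasure hd hq hp,
    RandomCluster.percProb_mean_field hd hq, fun p hp h => ?_⟩
  obtain ⟨c, hc, hdecay⟩ := RandomCluster.boxEv_crossing_exp_decay hd hq hp.1 h
  refine ⟨c, hc, fun n hn => ?_⟩
  rw [RandomCluster.boxMeasure_real hp (zero_lt_one.trans_le hq)]
  exact hdecay n hn
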